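/- **The model.** Let $n$ and $C\ge 1$ be integers and $\lambda>0$. Consider the complete graph on $V_n=\{1,\dots,n\}$, each of whose links has capacity $C$. For each pair $\{u,v\}$ of distinct nodes, calls with endpoints $u,v$ arrive as a Poisson process of rate $\lambda$, independently for different pairs (so the total rate is $\lambda\binom n2$ and the endpoints are uniform). A call with endpoints $u,v$ is routed over the direct link $\{u,v\}$ if fewer than $C$ calls currently use that link. Otherwise one node $w\in V_n\setminus\{u,v\}$ is chosen uniformly at random (the case $d=1$), and the call is routed along the two links $\{u,w\},\{v,w\}$ if each of them is used by fewer than $C$ calls; if not, the call is lost. A call in progress occupies one unit of capacity of each link on its route. Call durations are exponential with mean $1$; durations, arrivals and choices are independent. A load vector $x$ records the number $x(\{u,v\},0)$ of directly routed calls in progress between $u$ and $v$ and the number $x(\{u,v\},w)$ of calls in progress between $u$ and $v$ routed via $w$. The load of a link is $$x(\{u,v\})=x(\{u,v\},0)+\sum_{w\ne u,v}\big(x(\{u,w\},v)+x(\{v,w\},u)\big),$$ and the states are the load vectors in which every link has load at most $C$. Let $X=(X_t)_{t\ge0}$ be the resulting continuous-time Markov chain, with right-continuous paths, on the states. **Notation.**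 Let $\|x\|_1$ be the total number of calls in progress in $x$, let $f_{v,k}(x)$ be the number of links at node $v$ with load exactly $k$, and let $\mathbb I^j_{uv}(x)$ be $1$ if $u\neq v$ and $x(\{u,v\})=j$, and $0$ otherwise. Put $\phi=\max\{\phi^1,\phi^2,\phi^3\}$, where, with maxima over distinct nodes $u,v$ and over $j,k\in\{0,\dots,C\}$, $$\phi^1(x)=\max_{u,v,j,k}\Big|\frac1{n-2}\sum_{w}\mathbb I^j_{uw}(x)\mathbb I^k_{vw}(x)-\frac1{(n-2)^2}\sum_{w\ne u,v}\mathbb I^j_{uw}(x)\sum_{w'\ne u,v}\mathbb I^k_{vw'}(x)\Big|,$$ $$\phi^2(x)=\max_{u,v,j}\frac{1}{n-2}\big|f_{u,j}(x)-f_{v,j}(x)\big|,\qquad \phi^3(x)=\max_{u,v}\frac1{n-2}\sum_{w\ne u,v}x(\{u,v\},w).$$ Define $F:\mathbb R^{C+1}\to\mathbb R^{C+1}$, with $g_j(\xi)=2\xi(C)(1-\xi(C))\xi(j)$ for $0\le j\le C-1$, by $$F_0(\xi)=-\lambda\xi(0)-\lambda g_0(\xi)+\xi(1),$$ $$F_k(\xi)=\lambda\xi(k-1)-\lambda\xi(k)+\lambda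 g_{k-1}(\xi)-\lambda g_k(\xi)-k\xi(k)+(k+1)\xi(k+1)\quad(0<k<C),$$ $$F_C(\xi)=\lambda\xi(C-1)+\lambda g_{C-1}(\xi)-C\xi(C).$$ **Theorem 1.2.** Let $\lambda,t_0>0$ be real and let $C\ge1$ be an integer. Set $$\gamma=\frac{1}{2^{25}(1+C/\lambda)(8\lambda t_0+1)^3e^{800\lambda t_0}},$$ and suppose that $$n\ge\max\Big(2^{18}(\lambda+1/\lambda)^4(C+1)^6(t_0+1/t_0)^2,\ e^{8/\gamma}\Big).$$ Let $\xi_0\in\mathbb R^{C+1}$ have non-negative entries with $\sum_{k=0}^C\xi_0(k)=1$, and suppose that $\|X_0\|_1\le2\lambda\binom n2$ almost surely. Then the differential equation $d\xi_t/dt=F(\xi_t)$ with initial value $\xi_0$ has a unique solution $(\xi_t)$ on $[0,t_0]$. Moreover, let $B_n$ be the event that, for all $v\in V_n$, $k\in\{0,\dots,C\}$ and $t\in[0,t_0]$, $$|f_{v,k}(X_t)-(n-1)\xi_t(k)|\le\Big(\sup_{u,j}\big|f_{u,j}(X_0)-(n-1)\xi_0(j)\big|+64(\lambda+1)(t_0+1)(C+1)^3\big(n\phi(X_0)+3n^{1/2}\log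 n\big)\Big)e^{216(\lambda+1)(C+1)t_0},$$ where the supremum is over $u\in V_n$ and $j\in\{0,\dots,C\}$. Then $\mathbb P(\overline{B_n})\le e^{-\frac12\gamma\log^2n}$. -/

import Mathlib

open Set Filter Topology MeasureTheory
open scoped NNReal ENNReal

namespace Routing

noncomputable section

/-- A route in the complete graph on the node set `Fin n`, for a call whose endpoints are the two
elements of `ends`: the direct link if `mid = none`, and the two-link path through `w` if
`mid = some w`. A link is an off-diagonal element of `Sym2 (Fin n)`. -/
@[ext] structure Route (n : ℕ) where
  ends : Sym2 (Fin n)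
  mid : Option (Fin n)
  ends_ne : ¬ ends.IsDiag
  mid_ne : ∀ w ∈ mid, w ∉ ends

instance (n : ℕ) : Finite (Route n) :=
  Finite.of_injective (fun r : Route n => (r.ends, r.mid)) fun _ _ h =>
    Route.ext (congrArg Prod.fst h) (congrArg Prod.snd h)

instance (n : ℕ) : Fintype (Route n) := Fintype.ofFinite _

/-- The route `r` occupies the link `e`. -/
def Route.Uses {n : ℕ} (r : Route n) (e : Sym2 (Fin n)) : Prop :=
  match r.mid with
  | none => e = r.ends
  | some w => ∃ a ∈ r.ends, e = s(a, w)

lemma Route.exists_uses {n : ℕ} (r : Route n) : ∃ e, r.Uses e := by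
  obtain ⟨e, m, he, hm⟩ := r
  cases m with
  | none => exact ⟨e, rfl⟩
  | some w =>
    induction e using Sym2.ind with
    | _ a b => exact ⟨s(a, w), a, Sym2.mem_mk_left a b, rfl⟩

open scoped Classical in
/-- A load vector `x` gives the number `x r` of calls in progress on each route `r`. The load of
the link `e` is the number of calls in progress whose route occupies `e`. -/
def linkLoad {n : ℕ} (x : Route n → ℕ) (e : Sym2 (Fin n)) : ℕ :=
  ∑ r with r.Uses e, x r

/-- The states of the network: load vectors that respect the capacity `C` of each link. -/
def State (n C : ℕ) : Type := {x : Route n → ℕ // ∀ e, linkLoad x e ≤ C}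

lemma State.le {n C : ℕ} (x : State n C) (r : Route n) : x.1 r ≤ C := by
  classical
  obtain ⟨e, he⟩ := r.exists_uses
  refine le_trans ?_ (x.2 e)
  unfold linkLoad
  exact Finset.single_le_sum (f := x.1) (fun _ _ => Nat.zero_le _) (by simp [he])

instance (n C : ℕ) : Finite (State n C) :=
  Finite.of_injective
    (fun (x : State n C) (r : Route n) => (⟨x.1 r, Nat.lt_succ_of_le (x.le r)⟩ : Fin (C + 1)))
    fun _ _ h => Subtype.ext (funext fun r => congrArg Fin.val (congrFun h r))

instance (n C : ℕ) : Fintype (State n C) := Fintype.ofFinite _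

instance (n C : ℕ) : DecidableEq (State n C) := Classical.decEq _

open scoped Classical in
/-- The rate at which calls join the route `r` in state `x`. Calls arrive at total rate
`lam * n.choose 2` with uniform endpoints, so at rate `lam` for each pair of endpoints. A call takes
its direct link if that link is not full. Otherwise one of the `n - 2` possible intermediate nodes
is chosen uniformly, and the call takes the two-link route through it if neither of its links is
full; if one of them is full, then the call is lost. -/
def arrivalRate {n : ℕ} (lam : ℝ) (C : ℕ) (x : Route n → ℕ) (r : Route n) : ℝ :=
  match r.mid with
  | none => if linkLoad x r.ends < C then lam else 0
  | some _ =>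
    if C ≤ linkLoad x r.ends ∧ ∀ e, r.Uses e → linkLoad x e < C then lam / ((n : ℝ) - 2) else 0

open scoped Classical in
/-- The rate of jumps from `x` to `y`. Call durations are exponential with mean one, so that a call
leaves the route `r` at rate `x r`. -/
def jumpRate {n C : ℕ} (lam : ℝ) (x y : State n C) : ℝ :=
  ∑ r : Route n,
    ((if y.1 = x.1 + Pi.single r 1 then arrivalRate lam C x.1 r else 0) +
      (if x.1 = y.1 + Pi.single r 1 then (x.1 r : ℝ) else 0))

/-- The generator matrix of the network. -/
def generator (n C : ℕ) (lam : ℝ) : Matrix (State n C) (State n C) ℝ :=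
  fun x y => if x = y then - ∑ z with z ≠ x, jumpRate lam x z else jumpRate lam x y

/-- `X` is a continuous-time Markov chain with right-continuous paths (for the discrete topology of
the state space) and transition probabilities `exp (t Q)`, where `Q` is the generator matrix of the
network. Its initial distribution is arbitrary. -/
structure IsRoutingProcess {Ω : Type*} [MeasurableSpace Ω] (P : Measure Ω) (n C : ℕ) (lam : ℝ)
    (X : ℝ≥0 → Ω → State n C) : Prop where
  measurable : ∀ t y, MeasurableSet {ω | X t ω = y}
  right_continuous : ∀ᵐ ω ∂P, ∀ t : ℝ≥0, ∀ᶠ s in 𝓝[≥] t, X s ω = X t ω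
  markov : ∀ (m : ℕ) (t : Fin (m + 1) → ℝ≥0), Monotone t → ∀ x : Fin (m + 1) → State n C,
    P.real {ω | ∀ i, X (t i) ω = x i} =
      P.real {ω | X (t 0) ω = x 0} *
        ∏ i : Fin m, NormedSpace.exp
          (((t i.succ : ℝ) - (t i.castSucc : ℝ)) • generator n C lam) (x i.castSucc) (x i.succ)

/-- The indicator that the link `{u, v}` has load `j`; it is zero if `u = v`. -/
def ind {n : ℕ} (x : Route n → ℕ) (u v : Fin n) (j : ℕ) : ℝ :=
  if u ≠ v ∧ linkLoad x s(u, v) = j then 1 else 0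

/-- The number of links at the node `v` with load exactly `k`. -/
def numLinks {n : ℕ} (x : Route n → ℕ) (v : Fin n) (k : ℕ) : ℕ :=
  Finset.card {w : Fin n | w ≠ v ∧ linkLoad x s(v, w) = k}

/-- Ordered pairs of distinct nodes. -/
abbrev Pairs (n : ℕ) : Type := {p : Fin n × Fin n // p.1 ≠ p.2}

def phi1 {n : ℕ} (C : ℕ) (x : Route n → ℕ) : ℝ :=
  ⨆ q : Pairs n × Fin (C + 1) × Fin (C + 1),
    let u := q.1.1.1
    let v := q.1.1.2
    |1 / ((n : ℝ) - 2) * ∑ w, ind x u w q.2.1 * ind x v w q.2.2 -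
      1 / ((n : ℝ) - 2) ^ 2 * ((∑ w with w ≠ u ∧ w ≠ v, ind x u w q.2.1) *
        ∑ w with w ≠ u ∧ w ≠ v, ind x v w q.2.2)|

def phi2 {n : ℕ} (C : ℕ) (x : Route n → ℕ) : ℝ :=
  ⨆ q : Pairs n × Fin (C + 1),
    1 / ((n : ℝ) - 2) * |(numLinks x q.1.1.1 q.2 : ℝ) - numLinks x q.1.1.2 q.2|

/-- The largest number, divided by `n - 2`, of indirectly routed calls with given endpoints. -/
def phi3 {n : ℕ} (x : Route n → ℕ) : ℝ :=
  ⨆ q : Pairs n,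
    1 / ((n : ℝ) - 2) * ((∑ r : Route n with r.ends = s(q.1.1, q.1.2) ∧ r.mid ≠ none, x r : ℕ) : ℝ)

def phi {n : ℕ} (C : ℕ) (x : Route n → ℕ) : ℝ := max (phi1 C x) (max (phi2 C x) (phi3 x))

/-- `2 ξ(C) (1 - ξ(C)) ξ(j)`. -/
def altRate {C : ℕ} (ξ : Fin (C + 1) → ℝ) (j : Fin (C + 1)) : ℝ :=
  2 * ξ (Fin.last C) * (1 - ξ (Fin.last C)) * ξ j

/-- The vector field of the limiting differential equation. -/
def drift (C : ℕ) (lam : ℝ) (ξ : Fin (C + 1) → ℝ) (k : Fin (C + 1)) : ℝ :=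
  (if 0 < (k : ℕ) then
      lam * ξ ⟨k - 1, by omega⟩ + lam * altRate ξ ⟨k - 1, by omega⟩
    else 0) +
  (if h : (k : ℕ) < C then
      -(lam * ξ k) - lam * altRate ξ k + ((k : ℝ) + 1) * ξ ⟨k + 1, by omega⟩
    else 0) -
  (k : ℝ) * ξ k

/-- `ξ` solves `dξ/dt = F(ξ)` on `[0, t₀]` with initial value `ξ₀`. -/
def IsSolution (C : ℕ) (lam t₀ : ℝ) (ξ₀ : Fin (C + 1) → ℝ) (ξ : ℝ → Fin (C + 1) → ℝ) : Prop :=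
  ξ 0 = ξ₀ ∧ ∀ t ∈ Icc 0 t₀, HasDerivWithinAt ξ (drift C lam (ξ t)) (Icc 0 t₀) t

/-- The constant `γ`. -/
def gam (lam : ℝ) (C : ℕ) (t₀ : ℝ) : ℝ :=
  1 / (2 ^ 25 * (1 + C / lam) * (8 * lam * t₀ + 1) ^ 3 * Real.exp (800 * lam * t₀))

/-- The error bound, for the initial state `x`. -/
def errorBound {n : ℕ} (lam : ℝ) (C : ℕ) (t₀ : ℝ) (ξ₀ : Fin (C + 1) → ℝ) (x : Route n → ℕ) : ℝ :=
  ((⨆ p : Fin n × Fin (C + 1), |(numLinks x p.1 p.2 : ℝ) - ((n : ℝ) - 1) * ξ₀ p.2|) +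
      64 * (lam + 1) * (t₀ + 1) * ((C : ℝ) + 1) ^ 3 *
        (n * phi C x + 3 * (n : ℝ) ^ (1 / 2 : ℝ) * Real.log n)) *
    Real.exp (216 * (lam + 1) * ((C : ℝ) + 1) * t₀)

end

end Routing

/-! While a link `{v, w}` is not full, it gains calls at rate `lam * (1 + altShare)`, and it loses
calls at a rate equal to its load. Since `a(1-b) + b(1-a) = a + b - 2ab`, the share `altShare` is
determined, up to the link `{v, w}` itself, by the number of full links at `v` and at `w` and by the
number of third nodes joined to both by full links. So three families of observables nearly close up
under the generator: `starCount` (links at `v` with load `k`), `pairCount` (third nodes with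
prescribed loads towards `u` and `v`) and `indirectCount`. The last one is needed because the
product rule for two links `{u, w}`, `{v, w}` fails only through jumps of calls occupying both,
which are the indirect calls between `u` and `v`.

If the star counts are within `E` of `(n-1) ζ k`, the pair counts within `2E` of `(n-2) ζ j ζ k`,
and the indirect counts at most `2E` (`CloseTo`), then the generator acts on the star and pair
counts as the limiting equation does, up to an error linear in `E` plus a multiple of `lam`, and
increases indirect counts at rate at most `lam` (`CloseTo.abs_genAct_starCount_sub_le`,
`CloseTo.abs_genAct_pairCount_sub_le`, `genAct_indirectCount_le`). As long as the martingale parts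
are small, a Gronwall argument propagates the initial closeness (`closeTo_of_martingale_bounds`),
and `phi` controls the initial deviations of the pair and indirect counts.

Each observable jumps by at most 4 and has quadratic variation of order `n` per unit time, so an
exponential supermartingale shows that its martingale part exceeds `√n log n` with probability
`exp(-c log² n)`; a union bound over order `n² (C+1)²` observables costs little. All of this is done
for the chain sampled on a grid of mesh `t₀ / 2 ^ m`, whose kernel is `exp(hQ)`. Only at the end do
right-continuity of the paths and continuity of the solution carry the bound to all times. -/

namespace Routing

/-! ### Exponential maximal inequality for a finite chain sampled on a time grid -/

section Chain

variable {S : Type*}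

/-- The product of the transition weights along a path. -/
def pathWeight (p : S → S → ℝ) {N : ℕ} (y : Fin (N + 1) → S) : ℝ :=
  ∏ i : Fin N, p (y i.castSucc) (y i.succ)

/-- At some time the increment of `g` along the path exceeds its compensator by at least `a`. -/
def Exceeds (g c : S → ℝ) (a : ℝ) {N : ℕ} (y : Fin (N + 1) → S) : Prop :=
  ∃ i, a ≤ g (y i) - g (y 0) - ∑ l, if l < i then c (y l) else 0

lemma pathWeight_cons (p : S → S → ℝ) {N : ℕ} (x : S) (y : Fin (N + 1) → S) :
    pathWeight p (Fin.cons x y : Fin (N + 2) → S) = p x (y 0) * pathWeight p y := by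
  simp [pathWeight, Fin.prod_univ_succ]

lemma pathWeight_nonneg {p : S → S → ℝ} (hp : ∀ x y, 0 ≤ p x y) {N : ℕ} (y : Fin (N + 1) → S) :
    0 ≤ pathWeight p y :=
  Finset.prod_nonneg fun _ _ => hp _ _

/-- This is conditioning on the first step: unless the threshold is reached at time 0, the rest of
the path must exceed the threshold reduced by the first compensated increment. -/
lemma exceeds_cons {g c : S → ℝ} {a : ℝ} {N : ℕ} {x : S} {y : Fin (N + 1) → S}
    (h : Exceeds g c a (Fin.cons x y : Fin (N + 2) → S)) :
    a ≤ 0 ∨ Exceeds g c (a - (g (y 0) - g x - c x)) y := by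
  obtain ⟨i, hi⟩ := h
  induction i using Fin.cases with
  | zero => left; simpa using hi
  | succ i =>
    right
    refine ⟨i, ?_⟩
    rw [Fin.sum_univ_succ] at hi
    simp only [Fin.cons_succ, Fin.cons_zero, Fin.succ_pos, if_true, Fin.succ_lt_succ_iff] at hi
    linarith

lemma sum_fin_succ [Fintype S] {N : ℕ} (f : (Fin (N + 1) → S) → ℝ) :
    ∑ y, f y = ∑ x, ∑ z : Fin N → S, f (Fin.cons x z) := by
  rw [← (Fin.consEquiv fun _ => S).sum_comp, Fintype.sum_prod_type]
  rfl

variable [Fintype S] [DecidableEq S]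

lemma hasSum_exp_apply (A : Matrix S S ℝ) (x y : S) :
    HasSum (fun k : ℕ => ((k.factorial : ℝ)⁻¹) * (A ^ k) x y) (NormedSpace.exp A x y) := by
  have h : HasSum (fun k : ℕ => ((k.factorial : ℝ)⁻¹) • A ^ k) (NormedSpace.exp A) := by
    open scoped Matrix.Norms.Operator in
    exact NormedSpace.exp_series_hasSum_exp' (𝕂 := ℝ) A
  simpa using Pi.hasSum.1 (Pi.hasSum.1 h x) y

lemma exp_mul_apply_nonneg {A : Matrix S S ℝ} (hA : ∀ x y, 0 ≤ A x y) (x y : S) :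
    0 ≤ NormedSpace.exp A x y := by
  have hp : ∀ (k : ℕ) x y, 0 ≤ (A ^ k) x y := by
    intro k
    induction k with
    | zero => intro x y; simp only [pow_zero, Matrix.one_apply]; split_ifs <;> simp
    | succ k ih =>
      intro x y
      rw [pow_succ, Matrix.mul_apply]
      exact Finset.sum_nonneg fun z _ => mul_nonneg (ih x z) (hA z y)
  exact (hasSum_exp_apply A x y).nonneg fun k => mul_nonneg (by positivity) (hp k x y)

lemma hasDerivAt_exp_smul_apply (A : Matrix S S ℝ) (x y : S) :
    HasDerivAt (fun t : ℝ => NormedSpace.exp (t • A) x y) (A x y) 0 := by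
  open scoped Matrix.Norms.Operator in
  have h := hasDerivAt_exp_smul_const (𝕂 := ℝ) A (0 : ℝ)
  have h2 := ((LinearMap.toContinuousLinearMap
    (Matrix.entryLinearMap ℝ ℝ x y)).hasFDerivAt.comp_hasDerivAt (0 : ℝ) h)
  simp only [zero_smul, NormedSpace.exp_zero, one_mul] at h2
  exact h2

/-- Every power `A ^ k` with `k ≥ 1` has zero row sums, so only the identity term of the series
contributes. -/
lemma sum_exp_apply {A : Matrix S S ℝ} (hA : ∀ x, ∑ y, A x y = 0) (x : S) :
    ∑ y, NormedSpace.exp A x y = 1 := by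
  have h := hasSum_sum (s := Finset.univ) fun y _ => hasSum_exp_apply A x y
  refine h.unique ?_
  have hz : ∀ k : ℕ, k ≠ 0 → ∑ y, ((k.factorial : ℝ)⁻¹) * (A ^ k) x y = 0 := by
    intro k hk
    obtain ⟨k, rfl⟩ := Nat.exists_eq_succ_of_ne_zero hk
    rw [← Finset.mul_sum, pow_succ]
    simp only [Matrix.mul_apply]
    rw [Finset.sum_comm]
    simp [← Finset.mul_sum, hA]
  convert hasSum_single 0 hz using 1
  simp [Matrix.one_apply]

/-- Uniformization: for large `c` the matrix `A + c • 1` is entrywise non-negative, and the scalar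
shift commutes with it, so it only contributes a factor `exp(-tc)`. -/
lemma exp_smul_apply_nonneg {A : Matrix S S ℝ} (hA : ∀ x y, x ≠ y → 0 ≤ A x y) {t : ℝ}
    (ht : 0 ≤ t) (x y : S) : 0 ≤ NormedSpace.exp (t • A) x y := by
  obtain ⟨c, hc⟩ : ∃ c : ℝ, ∀ z, -A z z ≤ c :=
    ⟨∑ z, |A z z|, fun z => (neg_le_abs _).trans
      (Finset.single_le_sum (f := fun z => |A z z|) (fun _ _ => abs_nonneg _) (Finset.mem_univ z))⟩
  have hdec : t • A = t • (A + c • 1) + Matrix.diagonal (fun _ => -(t * c)) := by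
    ext a b
    by_cases hab : a = b <;> simp [Matrix.diagonal, hab]
  rw [hdec, Matrix.exp_add_of_commute, Matrix.exp_diagonal, Matrix.mul_diagonal]
  · refine mul_nonneg (exp_mul_apply_nonneg (fun a b => ?_) x y) ?_
    · simp only [Matrix.smul_apply, Matrix.add_apply, smul_eq_mul]
      refine mul_nonneg ht ?_
      by_cases hab : a = b
      · subst hab; simp; linarith [hc a]
      · simpa [Matrix.one_apply, hab] using hA a b hab
    · rw [Pi.coe_exp]
      simp only [← Real.exp_eq_exp_ℝ]
      positivity
  · rw [show Matrix.diagonal (fun _ : S => -(t * c)) = (-(t * c)) • (1 : Matrix S S ℝ) from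
      (Matrix.smul_one_eq_diagonal _).symm]
    exact (Commute.one_right _).smul_right _

omit [DecidableEq S] in
lemma sum_pathWeight {p : S → S → ℝ} (hp1 : ∀ x, ∑ y, p x y = 1) (N : ℕ) (x : S) :
    ∑ z : Fin N → S, pathWeight p (Fin.cons x z : Fin (N + 1) → S) = 1 := by
  induction N generalizing x with
  | zero => simp [pathWeight]
  | succ N ih =>
    rw [sum_fin_succ]
    simp only [pathWeight_cons, Fin.cons_zero, ← Finset.mul_sum, ih, mul_one, hp1]

open scoped Classical in
omit [DecidableEq S] in
/-- A maximal inequality for finite Markov chains. -/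
lemma sum_pathWeight_exceeds_le {p : S → S → ℝ} (hp : ∀ x y, 0 ≤ p x y)
    (hp1 : ∀ x, ∑ y, p x y = 1) {g c : S → ℝ}
    (hgc : ∀ x, ∑ y, p x y * Real.exp (g y - g x - c x) ≤ 1) (N : ℕ) (a : ℝ) (x : S) :
    ∑ z : Fin N → S, (if Exceeds g c a (Fin.cons x z : Fin (N + 1) → S) then
      pathWeight p (Fin.cons x z : Fin (N + 1) → S) else 0) ≤ Real.exp (-a) := by
  induction N generalizing a x with
  | zero =>
    simp only [Finset.univ_unique, Finset.sum_singleton, pathWeight, Finset.univ_eq_empty,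
      Finset.prod_empty]
    split_ifs with h
    · obtain ⟨i, hi⟩ := h
      obtain rfl : i = 0 := by omega
      simp at hi
      exact Real.one_le_exp (by linarith)
    · positivity
  | succ N ih =>
    -- For `a ≤ 0` the bound is at least the total mass 1 of the paths. For `a > 0` the time 0
    -- cannot be the exceeding time, and the induction hypothesis applies after the first step.
    rcases le_or_gt a 0 with ha | ha
    · calc _ ≤ ∑ z : Fin (N + 1) → S, pathWeight p (Fin.cons x z : Fin (N + 2) → S) := by
            refine Finset.sum_le_sum fun z _ => ?_
            split_ifs
            · exact le_rfl
            · exact pathWeight_nonneg hp _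
        _ = 1 := sum_pathWeight hp1 _ _
        _ ≤ _ := Real.one_le_exp (by linarith)
    · rw [sum_fin_succ]
      calc _ ≤ ∑ y, p x y * ∑ z : Fin N → S,
              (if Exceeds g c (a - (g y - g x - c x)) (Fin.cons y z : Fin (N + 1) → S) then
                pathWeight p (Fin.cons y z : Fin (N + 1) → S) else 0) := by
            refine Finset.sum_le_sum fun y _ => ?_
            rw [Finset.mul_sum]
            refine Finset.sum_le_sum fun z _ => ?_
            rw [pathWeight_cons, Fin.cons_zero]
            split_ifs with h1 h2 h2
            · exact le_rfl
            · rcases exceeds_cons h1 with h | h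
              · linarith
              · exact absurd h h2
            · exact mul_nonneg (hp _ _) (pathWeight_nonneg hp _)
            · simp
        _ ≤ ∑ y, p x y * Real.exp (-(a - (g y - g x - c x))) :=
            Finset.sum_le_sum fun y _ => mul_le_mul_of_nonneg_left (ih _ _) (hp _ _)
        _ = Real.exp (-a) * ∑ y, p x y * Real.exp (g y - g x - c x) := by
            rw [Finset.mul_sum]
            refine Finset.sum_congr rfl fun y _ => ?_
            rw [mul_left_comm, ← Real.exp_add]
            ring_nf
        _ ≤ _ := mul_le_of_le_one_right (Real.exp_nonneg _) (hgc x)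

/-- Exponential bound for one step of the chain with generator `Q`. -/
lemma eventually_sum_exp_smul_mul_exp_le {Q : Matrix S S ℝ} (hQ : ∀ x y, x ≠ y → 0 ≤ Q x y)
    (hQ0 : ∀ x, ∑ y, Q x y = 0) {g : S → ℝ} {V ε : ℝ} (hε : 0 < ε)
    (hg1 : ∀ x y, x ≠ y → Q x y ≠ 0 → |g y - g x| ≤ 1)
    (hgV : ∀ x, ∑ y, Q x y * (g y - g x) ^ 2 ≤ V) :
    ∀ᶠ h : ℝ in 𝓝[>] 0, ∀ x, ∑ y, NormedSpace.exp (h • Q) x y *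
      Real.exp (g y - g x - h * (∑ z, Q x z * (g z - g x) + (V + ε))) ≤ 1 := by
  refine eventually_all.2 fun x => ?_
  have hd : HasDerivAt (fun h : ℝ => ∑ y, NormedSpace.exp (h • Q) x y * Real.exp (g y - g x))
      (∑ y, Q x y * Real.exp (g y - g x)) 0 :=
    HasDerivAt.fun_sum fun y _ => (hasDerivAt_exp_smul_apply Q x y).mul_const _
  have h0 : ∑ y, NormedSpace.exp ((0 : ℝ) • Q) x y * Real.exp (g y - g x) = 1 := by
    simp [Matrix.one_apply]
  -- Zero row sums allow subtracting 1 from the exponential; then `exp u - 1 ≤ u + u²` for `|u| ≤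
  -- 1`.
  have hb : ∑ y, Q x y * Real.exp (g y - g x) ≤ ∑ z, Q x z * (g z - g x) + V := by
    calc ∑ y, Q x y * Real.exp (g y - g x)
        = ∑ y, Q x y * (Real.exp (g y - g x) - 1) := by
          simp only [mul_sub, Finset.sum_sub_distrib, mul_one, hQ0, sub_zero]
      _ ≤ ∑ y, (Q x y * (g y - g x) + Q x y * (g y - g x) ^ 2) := by
          refine Finset.sum_le_sum fun y _ => ?_
          by_cases hxy : x = y
          · subst hxy; simp
          by_cases hq : Q x y = 0
          · simp [hq]
          have := (abs_le.1 (Real.abs_exp_sub_one_sub_id_le (hg1 x y hxy hq))).2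
          rw [← mul_add]
          exact mul_le_mul_of_nonneg_left (by linarith) (hQ x y hxy)
      _ ≤ _ := by rw [Finset.sum_add_distrib]; linarith [hgV x]
  -- The slack `ε` turns the bound on the derivative at 0 into a bound for small positive `h`: the
  -- expectation is at most `1 + h * D ≤ exp (h * D)`.
  have ht := (hasDerivAt_iff_tendsto_slope.1 hd).eventually (gt_mem_nhds (lt_add_of_pos_right _ hε))
  have ht' := ht.filter_mono (nhdsWithin_mono (0 : ℝ) (s := Ioi 0) fun t (ht : 0 < t) => ht.ne')
  filter_upwards [ht', self_mem_nhdsWithin] with h hh (hpos : 0 < h)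
  rw [slope_def_field, h0, sub_zero, div_lt_iff₀ hpos] at hh
  set D := ∑ z, Q x z * (g z - g x) + (V + ε) with hD
  calc _ = (∑ y, NormedSpace.exp (h • Q) x y * Real.exp (g y - g x)) * Real.exp (-(h * D)) := by
        rw [Finset.sum_mul]
        refine Finset.sum_congr rfl fun y _ => ?_
        rw [mul_assoc, ← Real.exp_add]
        ring_nf
    _ ≤ Real.exp (h * D) * Real.exp (-(h * D)) := by
        refine mul_le_mul_of_nonneg_right ?_ (Real.exp_nonneg _)
        have h1 := Real.add_one_le_exp (h * D)
        nlinarith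
    _ = 1 := by rw [← Real.exp_add]; simp

open scoped Classical in
/-- Exponential deviation inequality for the martingale part of `g` on a time grid. -/
lemma eventually_sum_pathWeight_exceeds_le {Q : Matrix S S ℝ} (hQ : ∀ x y, x ≠ y → 0 ≤ Q x y)
    (hQ0 : ∀ x, ∑ y, Q x y = 0) {g : S → ℝ} {V ε : ℝ} (hε : 0 < ε) (hV : 0 ≤ V)
    (hg1 : ∀ x y, x ≠ y → Q x y ≠ 0 → |g y - g x| ≤ 1)
    (hgV : ∀ x, ∑ y, Q x y * (g y - g x) ^ 2 ≤ V) :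
    ∀ᶠ h : ℝ in 𝓝[>] 0, ∀ (N : ℕ) (a : ℝ) (x : S),
      ∑ z : Fin N → S, (if Exceeds g (fun x => h * ∑ z, Q x z * (g z - g x)) a
          (Fin.cons x z : Fin (N + 1) → S) then
        pathWeight (fun x y => NormedSpace.exp (h • Q) x y)
          (Fin.cons x z : Fin (N + 1) → S) else 0) ≤
      Real.exp (-a + N * h * (V + ε)) := by
  filter_upwards [eventually_sum_exp_smul_mul_exp_le hQ hQ0 hε hg1 hgV, self_mem_nhdsWithin]
    with h hh (hpos : 0 < h) N a x
  have hp : ∀ x y, 0 ≤ NormedSpace.exp (h • Q) x y := exp_smul_apply_nonneg hQ hpos.le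
  have hp1 : ∀ x, ∑ y, NormedSpace.exp (h • Q) x y = 1 :=
    sum_exp_apply fun x => by simp [← Finset.mul_sum, hQ0]
  refine le_trans (Finset.sum_le_sum fun z _ => ?_) ((sum_pathWeight_exceeds_le hp hp1 hh N
    (a - N * h * (V + ε)) x).trans_eq (by ring_nf))
  -- The two compensators differ by `h * (V + ε)` per step, hence by at most `N * h * (V + ε)`,
  -- which is moved into the threshold.
  have himp : ∀ y : Fin (N + 1) → S, Exceeds g (fun x => h * ∑ z, Q x z * (g z - g x)) a y →
      Exceeds g (fun x => h * (∑ z, Q x z * (g z - g x) + (V + ε))) (a - N * h * (V + ε)) y := by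
    rintro y ⟨i, hi⟩
    refine ⟨i, ?_⟩
    have h1 : ∑ l, (if l < i then h * (∑ z, Q (y l) z * (g z - g (y l)) + (V + ε)) else 0) =
        ∑ l, (if l < i then h * ∑ z, Q (y l) z * (g z - g (y l)) else 0) +
          ∑ l : Fin (N + 1), (if l < i then h * (V + ε) else 0) := by
      rw [← Finset.sum_add_distrib]
      refine Finset.sum_congr rfl fun l _ => ?_
      split_ifs <;> ring
    have h2 : ∑ l : Fin (N + 1), (if l < i then h * (V + ε) else 0) ≤ N * h * (V + ε) := by
      rw [← Finset.sum_filter, Finset.sum_const, nsmul_eq_mul, mul_assoc]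
      refine mul_le_mul_of_nonneg_right ?_ (by positivity)
      have : (Finset.univ.filter fun l : Fin (N + 1) => l < i) = Finset.Iio i := by ext; simp
      rw [this, Fin.card_Iio]
      exact_mod_cast Nat.lt_succ_iff.1 i.2
    rw [h1]
    linarith
  split_ifs with h1 h2 h2
  · exact le_rfl
  · exact absurd (himp _ h1) h2
  · exact pathWeight_nonneg hp _
  · exact le_refl (0 : ℝ)

open scoped Classical in
omit [DecidableEq S] in
/-- If every starting point gives the event `B` conditional probability at most `b`, then `B` has
probability at most `b`. -/
lemma measureReal_path_le {Ω : Type*} [MeasurableSpace Ω] {P : Measure Ω} [IsProbabilityMeasure P]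
    {N : ℕ} {Y : Ω → Fin (N + 1) → S} {p : S → S → ℝ}
    (hmeas : ∀ x, MeasurableSet {ω | Y ω 0 = x})
    (hY : ∀ y : Fin (N + 1) → S, P.real {ω | Y ω = y} = P.real {ω | Y ω 0 = y 0} * pathWeight p y)
    {B : (Fin (N + 1) → S) → Prop} {b : ℝ}
    (hB : ∀ x, ∑ z : Fin N → S, (if B (Fin.cons x z) then
      pathWeight p (Fin.cons x z : Fin (N + 1) → S) else 0) ≤ b) :
    P.real {ω | B (Y ω)} ≤ b := by
  have h1 : ∑ x, P.real {ω | Y ω 0 = x} = 1 := by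
    rw [← measureReal_biUnion_finset (by
      intro x _ y _ hxy
      exact Set.disjoint_left.2 fun ω (h1 : _ = _) (h2 : _ = _) => hxy (h1.symm.trans h2))
      fun x _ => hmeas x]
    rw [← probReal_univ (μ := P)]
    congr 1
    ext ω
    simp
  have hsub : {ω | B (Y ω)} ⊆ ⋃ y ∈ Finset.univ.filter B, {ω | Y ω = y} := by
    intro ω hω
    simpa using hω
  calc P.real {ω | B (Y ω)}
      ≤ P.real (⋃ y ∈ Finset.univ.filter B, {ω | Y ω = y}) :=
        measureReal_mono hsub (measure_ne_top _ _)
    _ ≤ ∑ y ∈ Finset.univ.filter B, P.real {ω | Y ω = y} := measureReal_biUnion_finset_le _ _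
    _ = ∑ x, P.real {ω | Y ω 0 = x} * ∑ z : Fin N → S, (if B (Fin.cons x z) then
          pathWeight p (Fin.cons x z : Fin (N + 1) → S) else 0) := by
        rw [Finset.sum_filter, sum_fin_succ]
        refine Finset.sum_congr rfl fun x _ => ?_
        rw [Finset.mul_sum]
        refine Finset.sum_congr rfl fun z _ => ?_
        split_ifs
        · rw [hY, Fin.cons_zero]
        · simp
    _ ≤ ∑ x, P.real {ω | Y ω 0 = x} * b :=
        Finset.sum_le_sum fun x _ => mul_le_mul_of_nonneg_left (hB x) measureReal_nonneg
    _ = b := by rw [← Finset.sum_mul, h1, one_mul]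
end Chain

/-! ### The generator acting on functions of the load vector -/

section Generator

open scoped Classical

variable {n C : ℕ} {lam : ℝ}

lemma linkLoad_add_single (x : Route n → ℕ) (r : Route n) (e : Sym2 (Fin n)) :
    linkLoad (x + Pi.single r 1) e = linkLoad x e + if r.Uses e then 1 else 0 := by
  simp only [linkLoad, Pi.add_apply, Finset.sum_add_distrib]
  congr 1
  simp

lemma sub_single_add_single {x : Route n → ℕ} {r : Route n} (hr : x r ≠ 0) :
    x - Pi.single r 1 + Pi.single r 1 = x := by
  funext s
  by_cases h : s = r
  · subst h; simp; omega
  · simp [h]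

lemma linkLoad_sub_single {x : Route n → ℕ} {r : Route n} (hr : x r ≠ 0) (e : Sym2 (Fin n)) :
    linkLoad x e = linkLoad (x - Pi.single r 1) e + if r.Uses e then 1 else 0 := by
  rw [← linkLoad_add_single, sub_single_add_single hr]

lemma arrivalRate_nonneg (hlam : 0 ≤ lam) (hn : 2 < n) (x : Route n → ℕ) (r : Route n) :
    0 ≤ arrivalRate lam C x r := by
  have : (0 : ℝ) ≤ lam / (n - 2) := by
    have : (2 : ℝ) < n := by exact_mod_cast hn
    exact div_nonneg hlam (by linarith)
  unfold arrivalRate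
  split <;> split_ifs <;> simp [*]

lemma linkLoad_lt_of_arrivalRate_ne_zero {x : Route n → ℕ} {r : Route n}
    (h : arrivalRate lam C x r ≠ 0) {e : Sym2 (Fin n)} (he : r.Uses e) : linkLoad x e < C := by
  unfold arrivalRate at h
  unfold Route.Uses at he
  split at h
  · next hm =>
    rw [hm] at he
    simp only at he
    subst he
    by_contra h'
    simp [h'] at h
  · next w hm =>
    split_ifs at h with h'
    · refine h'.2 e ?_
      simpa [Route.Uses, hm] using he
    · exact absurd rfl h

lemma linkLoad_add_single_le {x : State n C} {r : Route n} (h : arrivalRate lam C x.1 r ≠ 0)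
    (e : Sym2 (Fin n)) : linkLoad (x.1 + Pi.single r 1) e ≤ C := by
  rw [linkLoad_add_single]
  split_ifs with he
  · exact linkLoad_lt_of_arrivalRate_ne_zero h he
  · exact x.2 e

lemma linkLoad_sub_single_le (x : State n C) {r : Route n} (h : x.1 r ≠ 0)
    (e : Sym2 (Fin n)) : linkLoad (x.1 - Pi.single r 1) e ≤ C := by
  have := linkLoad_sub_single h e
  have := x.2 e
  omega

/-- Sums over the possible jumps from `x`, as sums over the routes. -/
lemma sum_jumpRate_mul (x : State n C) (ψ : (Route n → ℕ) → ℝ) :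
    ∑ y : State n C, jumpRate lam x y * ψ y.1 =
      ∑ r, (arrivalRate lam C x.1 r * ψ (x.1 + Pi.single r 1) +
        x.1 r * ψ (x.1 - Pi.single r 1)) := by
  simp only [jumpRate, Finset.sum_mul]
  rw [Finset.sum_comm]
  refine Finset.sum_congr rfl fun r _ => ?_
  simp only [add_mul, Finset.sum_add_distrib]
  congr 1
  -- If the rate is zero, the target of the jump may violate a capacity and not be a state, but the
  -- term vanishes. Otherwise the target is a state, and it is the only one that contributes.
  · by_cases h : arrivalRate lam C x.1 r = 0
    · simp [h]
    · refine (Finset.sum_eq_single (⟨x.1 + Pi.single r 1, linkLoad_add_single_le h⟩ : State n C)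
        (fun y _ hy => ?_) fun h' => absurd (Finset.mem_univ (α := State n C) _) h').trans (by simp)
      rw [if_neg fun h' => hy (Subtype.ext h'), zero_mul]
  · by_cases h : x.1 r = 0
    · simp [h]
    · refine (Finset.sum_eq_single (⟨x.1 - Pi.single r 1, linkLoad_sub_single_le x h⟩ : State n C)
        (fun y _ hy => ?_) fun h' => absurd (Finset.mem_univ (α := State n C) _) h').trans
        (by rw [if_pos (sub_single_add_single h).symm])
      rw [if_neg fun h' => hy (Subtype.ext ?_), zero_mul]
      simp [h']

/-- Since `ψ` vanishes at `x`, the diagonal entry of the generator plays no role. -/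
lemma sum_generator_mul (x : State n C) {ψ : (Route n → ℕ) → ℝ} (hψ : ψ x.1 = 0) :
    ∑ y : State n C, generator n C lam x y * ψ y.1 =
      ∑ r, (arrivalRate lam C x.1 r * ψ (x.1 + Pi.single r 1) +
        x.1 r * ψ (x.1 - Pi.single r 1)) := by
  rw [← sum_jumpRate_mul]
  refine Finset.sum_congr rfl fun y _ => ?_
  by_cases h : x = y
  · subst h; simp [hψ]
  · simp [generator, h]

lemma generator_nonneg (hlam : 0 ≤ lam) (hn : 2 < n) {x y : State n C} (h : x ≠ y) :
    0 ≤ generator n C lam x y := by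
  simp only [generator, h, if_false, jumpRate]
  refine Finset.sum_nonneg fun r _ => add_nonneg ?_ ?_
  · split_ifs
    · exact arrivalRate_nonneg hlam hn _ _
    · exact le_rfl
  · split_ifs <;> simp

lemma sum_generator (x : State n C) : ∑ y, generator n C lam x y = 0 := by
  rw [← Finset.add_sum_erase _ _ (Finset.mem_univ x)]
  have : Finset.univ.erase x = Finset.univ.filter (· ≠ x) := by ext; simp
  rw [this]
  simp only [generator, if_true]
  rw [neg_add_eq_zero]
  refine Finset.sum_congr rfl fun y hy => ?_
  rw [if_neg (Finset.mem_filter.1 hy).2.symm]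

lemma exists_of_generator_ne_zero {x y : State n C} (hxy : x ≠ y)
    (h : generator n C lam x y ≠ 0) :
    ∃ r, y.1 = x.1 + Pi.single r 1 ∨ (x.1 r ≠ 0 ∧ y.1 = x.1 - Pi.single r 1) := by
  simp only [generator, hxy, if_false, jumpRate] at h
  obtain ⟨r, -, hr⟩ := Finset.exists_ne_zero_of_sum_ne_zero h
  refine ⟨r, ?_⟩
  by_contra! hc
  refine hr ?_
  rw [if_neg hc.1, if_neg, add_zero]
  intro h'
  refine hc.2 ?_ ?_
  · rw [h']; simp
  · rw [h']; simp

/-- The generator applied to a function of the load vector. -/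
noncomputable def genAct (lam : ℝ) (C : ℕ) (g : (Route n → ℕ) → ℝ) (x : Route n → ℕ) : ℝ :=
  ∑ r, (arrivalRate lam C x r * (g (x + Pi.single r 1) - g x) +
    x r * (g (x - Pi.single r 1) - g x))

lemma sum_generator_mul_sub (g : (Route n → ℕ) → ℝ) (x : State n C) :
    ∑ y : State n C, generator n C lam x y * (g y.1 - g x.1) = genAct lam C g x.1 :=
  sum_generator_mul x (ψ := fun y => g y - g x.1) (sub_self _)

lemma genAct_sum {ι : Type*} (s : Finset ι) (g : ι → (Route n → ℕ) → ℝ) (x : Route n → ℕ) :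
    genAct lam C (fun y => ∑ i ∈ s, g i y) x = ∑ i ∈ s, genAct lam C (g i) x := by
  simp only [genAct]
  rw [Finset.sum_comm]
  refine Finset.sum_congr rfl fun r _ => ?_
  simp only [← Finset.sum_sub_distrib, Finset.mul_sum, Finset.sum_add_distrib]

/-- The rate at which calls join the link `e`. -/
noncomputable def linkRate (lam : ℝ) (C : ℕ) (x : Route n → ℕ) (e : Sym2 (Fin n)) : ℝ :=
  ∑ r with r.Uses e, arrivalRate lam C x r

/-- The indicator that the link `e` has load `k`. -/
noncomputable def level (x : Route n → ℕ) (e : Sym2 (Fin n)) (k : ℕ) : ℝ :=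
  if linkLoad x e = k then 1 else 0

lemma level_nonneg (x : Route n → ℕ) (e : Sym2 (Fin n)) (k : ℕ) : 0 ≤ level x e k := by
  unfold level; split_ifs <;> simp

lemma level_le_one (x : Route n → ℕ) (e : Sym2 (Fin n)) (k : ℕ) : level x e k ≤ 1 := by
  unfold level; split_ifs <;> simp

lemma level_add_single (x : Route n → ℕ) (r : Route n) (e : Sym2 (Fin n)) (k : ℕ) :
    level (x + Pi.single r 1) e k - level x e k = if r.Uses e then
      (if linkLoad x e + 1 = k then 1 else 0) - (if linkLoad x e = k then 1 else 0) else 0 := by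
  simp only [level, linkLoad_add_single]
  split_ifs <;> simp_all

lemma level_sub_single {x : Route n → ℕ} {r : Route n} (hr : x r ≠ 0) (e : Sym2 (Fin n)) (k : ℕ) :
    level (x - Pi.single r 1) e k - level x e k = if r.Uses e then
      (if linkLoad x e = k + 1 then 1 else 0) - (if linkLoad x e = k then 1 else 0) else 0 := by
  have := linkLoad_sub_single hr e
  simp only [level, this]
  split_ifs at this ⊢ <;> simp_all

/-- A single link is a birth-death process: each call on it ends at rate 1, so the departure rates
of the routes using `e` add up to its load. -/
lemma genAct_level (x : Route n → ℕ) (e : Sym2 (Fin n)) (k : ℕ) :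
    genAct lam C (fun y => level y e k) x =
      linkRate lam C x e *
        ((if linkLoad x e + 1 = k then 1 else 0) - (if linkLoad x e = k then 1 else 0)) +
      linkLoad x e *
        ((if linkLoad x e = k + 1 then 1 else 0) - (if linkLoad x e = k then 1 else 0)) := by
  simp only [genAct, Finset.sum_add_distrib]
  congr 1
  · rw [linkRate, Finset.sum_mul, Finset.sum_filter]
    refine Finset.sum_congr rfl fun r _ => ?_
    rw [level_add_single]
    split_ifs <;> simp
  · have h : (linkLoad x e : ℝ) = ∑ r with r.Uses e, (x r : ℝ) := by simp [linkLoad]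
    rw [h, Finset.sum_mul, Finset.sum_filter]
    refine Finset.sum_congr rfl fun r _ => ?_
    by_cases hr : x r = 0
    · simp [hr]
    rw [level_sub_single hr]
    split_ifs <;> simp

lemma abs_level_add_single (x : Route n → ℕ) (r : Route n) (e : Sym2 (Fin n)) (k : ℕ) :
    |level (x + Pi.single r 1) e k - level x e k| ≤ if r.Uses e then 1 else 0 := by
  rw [level_add_single]
  split_ifs <;> simp

lemma abs_level_sub_single {x : Route n → ℕ} {r : Route n} (hr : x r ≠ 0) (e : Sym2 (Fin n))
    (k : ℕ) : |level (x - Pi.single r 1) e k - level x e k| ≤ if r.Uses e then 1 else 0 := by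
  rw [level_sub_single hr]
  split_ifs <;> simp

/-- The product rule for the generator, up to jumps that change both factors. -/
lemma abs_genAct_level_mul_sub_le (hlam : 0 ≤ lam) (hn : 2 < n) (x : Route n → ℕ)
    (e e' : Sym2 (Fin n)) (j k : ℕ) :
    |genAct lam C (fun y => level y e j * level y e' k) x -
      (genAct lam C (fun y => level y e j) x * level x e' k +
        level x e j * genAct lam C (fun y => level y e' k) x)| ≤
      ∑ r, (arrivalRate lam C x r + x r) *
        ((if r.Uses e then 1 else 0) * (if r.Uses e' then 1 else 0)) := by
  simp only [genAct]
  rw [Finset.sum_mul, Finset.mul_sum, ← Finset.sum_add_distrib, ← Finset.sum_sub_distrib]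
  refine (Finset.abs_sum_le_sum_abs _ _).trans (Finset.sum_le_sum fun r _ => ?_)
  -- The error of the product rule is the product of the two increments, non-zero only if the route
  -- uses both links.
  have key : ∀ a b a' b' : ℝ, a' * b' - a * b - ((a' - a) * b + a * (b' - b)) =
      (a' - a) * (b' - b) := by intros; ring
  have ha := arrivalRate_nonneg (C := C) hlam hn x r
  calc _ = |arrivalRate lam C x r *
        ((level (x + Pi.single r 1) e j - level x e j) *
          (level (x + Pi.single r 1) e' k - level x e' k)) +
        x r * ((level (x - Pi.single r 1) e j - level x e j) *
          (level (x - Pi.single r 1) e' k - level x e' k))| := by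
        congr 1; ring
    _ ≤ _ := by
        rw [add_mul]
        refine (abs_add_le _ _).trans (add_le_add ?_ ?_)
        · rw [abs_mul, abs_mul, abs_of_nonneg ha]
          refine mul_le_mul_of_nonneg_left ?_ ha
          exact mul_le_mul (abs_level_add_single ..) (abs_level_add_single ..) (abs_nonneg _)
            (by split_ifs <;> simp)
        · by_cases hr : x r = 0
          · simp [hr]
          rw [abs_mul, abs_mul, Nat.abs_cast]
          refine mul_le_mul_of_nonneg_left ?_ (Nat.cast_nonneg _)
          exact mul_le_mul (abs_level_sub_single hr ..) (abs_level_sub_single hr ..) (abs_nonneg _)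
            (by split_ifs <;> simp)

end Generator

/-! ### Routes through a link, arrival rates, and links occupied at a node -/

section Links

open scoped Classical

variable {n C : ℕ} {lam : ℝ}

/-- The nodes different from `v` and `w`. -/
abbrev Others (v w : Fin n) : Type := {z : Fin n // z ≠ v ∧ z ≠ w}

lemma card_others {v w : Fin n} (h : v ≠ w) :
    (Finset.univ.filter fun z : Fin n => z ≠ v ∧ z ≠ w).card = n - 2 := by
  have : (Finset.univ.filter fun z : Fin n => z ≠ v ∧ z ≠ w) = Finset.univ \ {v, w} := by
    ext; simp
  rw [this, Finset.card_sdiff_of_subset (Finset.subset_univ _), Finset.card_pair h]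
  simp

/-- The two-link route from `v` to `z` through `w`. -/
def Route.via (v w : Fin n) (h : v ≠ w) (z : Others v w) : Route n where
  ends := s(v, z.1)
  mid := some w
  ends_ne := by simpa using z.2.1.symm
  mid_ne := by
    rintro _ ⟨⟩
    simp only [Sym2.mem_iff, not_or]
    exact ⟨h.symm, z.2.2.symm⟩

/-- The direct route. -/
def Route.direct (v w : Fin n) (h : v ≠ w) : Route n where
  ends := s(v, w)
  mid := none
  ends_ne := by simpa using h
  mid_ne := by simp

/-- The routes that occupy the link `{v, w}`. -/
def routesThrough (v w : Fin n) (h : v ≠ w) : Option (Others v w ⊕ Others w v) → Route n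
  | none => Route.direct v w h
  | some (Sum.inl z) => Route.via v w h z
  | some (Sum.inr z) => Route.via w v h.symm z

lemma routesThrough_injective {v w : Fin n} (h : v ≠ w) :
    Function.Injective (routesThrough v w h) := by
  rintro (_ | ⟨z, hz⟩ | ⟨z, hz⟩) (_ | ⟨z', hz'⟩ | ⟨z', hz'⟩) heq <;>
    simp only [routesThrough, Route.direct, Route.via, Route.ext_iff, Sym2.eq_iff, Option.some.injEq,
      reduceCtorEq, and_false] at heq <;> first | rfl | skip
  · have : z = z' := by tauto
    subst this; rfl
  · exact absurd heq.2.symm h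
  · exact absurd heq.2 h
  · have : z = z' := by tauto
    subst this; rfl

lemma uses_iff {v w : Fin n} (h : v ≠ w) (r : Route n) :
    r.Uses s(v, w) ↔ r ∈ Set.range (routesThrough v w h) := by
  constructor
  · obtain ⟨e, m, he, hm⟩ := r
    induction e using Sym2.ind with
    | _ a b =>
      cases m with
      | none =>
        intro hu
        exact ⟨none, Route.ext hu rfl⟩
      | some m =>
        rintro ⟨c, hc, heq⟩
        have hm' := hm m rfl
        obtain ⟨z, hz⟩ := Sym2.mem_iff_exists.1 (show c ∈ s(a, b) from hc)
        rw [hz] at he hm'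
        simp only [Sym2.mk_isDiag_iff, Sym2.mem_iff, not_or] at he hm'
        rcases Sym2.eq_iff.1 heq with ⟨rfl, rfl⟩ | ⟨rfl, rfl⟩
        · exact ⟨some (Sum.inl ⟨z, fun h => he h.symm, fun h => hm'.2 h.symm⟩),
            Route.ext hz.symm rfl⟩
        · exact ⟨some (Sum.inr ⟨z, fun h => he h.symm, fun h => hm'.2 h.symm⟩),
            Route.ext hz.symm rfl⟩
  · rintro ⟨_ | z | z, rfl⟩
    · rfl
    · exact ⟨v, by simp [Route.via, routesThrough], rfl⟩
    · exact ⟨w, by simp [Route.via, routesThrough], Sym2.eq_swap⟩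

lemma sum_uses {v w : Fin n} (h : v ≠ w) (a : Route n → ℝ) :
    ∑ r with r.Uses s(v, w), a r = a (Route.direct v w h) +
      (∑ z : Others v w, a (Route.via v w h z) + ∑ z : Others w v, a (Route.via w v h.symm z)) := by
  have : (Finset.univ.filter fun r : Route n => r.Uses s(v, w)) =
      Finset.univ.map ⟨_, routesThrough_injective h⟩ := by
    ext r
    simp [uses_iff h]
  rw [this, Finset.sum_map, Fintype.sum_option, Fintype.sum_sum_type]
  rfl

/-- The proportion of nodes `z` for which exactly one of the links `{v, z}` and `{w, z}` is full. -/
noncomputable def altShare (C : ℕ) (x : Route n → ℕ) (v w : Fin n) : ℝ :=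
  1 / ((n : ℝ) - 2) * ∑ z with z ≠ v ∧ z ≠ w,
    (level x s(v, z) C * (1 - level x s(w, z) C) + level x s(w, z) C * (1 - level x s(v, z) C))

lemma altShare_le_one (hn : 2 < n) (x : Route n → ℕ) {v w : Fin n} (h : v ≠ w) :
    altShare C x v w ≤ 1 := by
  have h2 : (2 : ℝ) < n := by exact_mod_cast hn
  have hb : ∑ z with z ≠ v ∧ z ≠ w,
      (level x s(v, z) C * (1 - level x s(w, z) C) +
        level x s(w, z) C * (1 - level x s(v, z) C)) ≤ (n : ℝ) - 2 := by
    refine (Finset.sum_le_card_nsmul _ _ 1 fun z _ => ?_).trans ?_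
    · unfold level; split_ifs <;> simp
    · rw [card_others h, nsmul_eq_mul, mul_one, Nat.cast_sub hn.le]
      simp
  rw [altShare, one_div, inv_mul_le_iff₀ (by linarith), mul_one]
  exact hb

/-- The call is between `v` and `z`: it overflows onto `v, w, z` exactly when `{v, z}` is full and
both links of the detour have room, and `{v, w}` has room by assumption. -/
lemma arrivalRate_via (x : State n C) {v w : Fin n} (h : v ≠ w) (z : Others v w)
    (hl : linkLoad x.1 s(v, w) < C) :
    arrivalRate lam C x.1 (Route.via v w h z) =
      lam / ((n : ℝ) - 2) * (level x.1 s(v, z.1) C * (1 - level x.1 s(w, z.1) C)) := by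
  have h1 := x.2 s(v, z.1)
  have h2 := x.2 s(w, z.1)
  have hu : (∀ e, (Route.via v w h z).Uses e → linkLoad x.1 e < C) ↔
      linkLoad x.1 s(w, z.1) < C := by
    constructor
    · intro H
      exact H _ ⟨z.1, by simp [Route.via], Sym2.eq_swap⟩
    · rintro H e ⟨a, ha, rfl⟩
      rcases Sym2.mem_iff.1 (show a ∈ s(v, z.1) from ha) with rfl | rfl
      · exact hl
      · rwa [Sym2.eq_swap]
  unfold arrivalRate
  simp only [Route.via] at hu ⊢
  simp only [hu, level]
  split_ifs <;> first | (exfalso; omega) | simp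

lemma linkRate_eq (x : State n C) {v w : Fin n} (h : v ≠ w)
    (hl : linkLoad x.1 s(v, w) < C) :
    linkRate lam C x.1 s(v, w) = lam * (1 + altShare C x.1 v w) := by
  rw [linkRate, sum_uses h]
  simp only [arrivalRate_via x h _ hl]
  simp only [arrivalRate_via x h.symm _ (Sym2.eq_swap (a := v) (b := w) ▸ hl)]
  have h1 : arrivalRate lam C x.1 (Route.direct v w h) = lam := by
    simp [arrivalRate, Route.direct, hl]
  rw [h1, altShare, Finset.sum_add_distrib, ← Finset.mul_sum, ← Finset.mul_sum,
    Finset.sum_subtype (p := fun z => z ≠ v ∧ z ≠ w) (Finset.univ.filter fun z => z ≠ v ∧ z ≠ w)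
      (by simp) (fun z => level x.1 s(v, z) C * (1 - level x.1 s(w, z) C)),
    Finset.sum_subtype (p := fun z => z ≠ w ∧ z ≠ v) (Finset.univ.filter fun z => z ≠ v ∧ z ≠ w)
      (by simp [and_comm]) (fun z => level x.1 s(w, z) C * (1 - level x.1 s(v, z) C))]
  ring

lemma linkRate_eq_zero {x : Route n → ℕ} {e : Sym2 (Fin n)} (hl : C ≤ linkLoad x e) :
    linkRate lam C x e = 0 := by
  refine Finset.sum_eq_zero fun r hr => ?_
  by_contra h
  exact absurd (linkLoad_lt_of_arrivalRate_ne_zero h (Finset.mem_filter.1 hr).2) (by omega)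

lemma linkRate_le (hlam : 0 ≤ lam) (hn : 2 < n) (x : State n C) {v w : Fin n} (h : v ≠ w) :
    linkRate lam C x.1 s(v, w) ≤ 2 * lam := by
  rcases lt_or_ge (linkLoad x.1 s(v, w)) C with hl | hl
  · rw [linkRate_eq x h hl]
    nlinarith [altShare_le_one (C := C) hn x.1 h]
  · rw [linkRate_eq_zero hl]; linarith

/-- The number of links at `v` that the route `r` occupies. -/
noncomputable def degAt (v : Fin n) (r : Route n) : ℝ :=
  ∑ w with w ≠ v, if r.Uses s(v, w) then 1 else 0

lemma degAt_nonneg (v : Fin n) (r : Route n) : 0 ≤ degAt v r :=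
  Finset.sum_nonneg fun _ _ => by split_ifs <;> simp

/-- A route meets `v` either as an endpoint, in one link, or as its middle node, in two. -/
lemma degAt_le_two (v : Fin n) (r : Route n) : degAt v r ≤ 2 := by
  obtain ⟨e, m, he, hm⟩ := r
  induction e using Sym2.ind with
  | _ a b =>
    have key : ∃ c d : Fin n, ∀ w, (⟨s(a, b), m, he, hm⟩ : Route n).Uses s(v, w) → w = c ∨ w = d := by
      cases m with
      | none =>
        refine ⟨a, b, fun w hw => ?_⟩
        have : s(v, w) = s(a, b) := hw
        rw [Sym2.eq_iff] at this
        tauto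
      | some m =>
        by_cases hv : v = m
        · refine ⟨a, b, ?_⟩
          rintro w ⟨c, hc, heq⟩
          have hc' : c = a ∨ c = b := Sym2.mem_iff.1 hc
          have hcm : c ≠ m := fun h => hm m rfl (h ▸ hc)
          rw [Sym2.eq_iff] at heq
          rcases heq with ⟨h1, h2⟩ | ⟨h1, h2⟩
          · exact absurd (h1.symm.trans hv) hcm
          · rw [h2]; exact hc'
        · refine ⟨m, m, ?_⟩
          rintro w ⟨c, hc, heq⟩
          rw [Sym2.eq_iff] at heq
          tauto
    obtain ⟨c, d, hcd⟩ := key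
    rw [degAt, Finset.sum_boole]
    have hsub : ((Finset.univ.filter fun w => w ≠ v).filter fun w =>
        (⟨s(a, b), m, he, hm⟩ : Route n).Uses s(v, w)) ⊆ {c, d} := by
      intro w hw
      simpa using hcd w (Finset.mem_filter.1 hw).2
    exact_mod_cast (Finset.card_le_card hsub).trans Finset.card_le_two

/-- After exchanging sums, each of the fewer than `n` links at `v` contributes its arrival rate, at
most `2 * lam`, and its load, at most `C`. This controls the quadratic variation of the observables.
-/
lemma sum_rate_mul_degAt_le (hlam : 0 ≤ lam) (hn : 2 < n) (x : State n C) (v : Fin n) :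
    ∑ r, (arrivalRate lam C x.1 r + x.1 r) * degAt v r ≤ n * (2 * lam + C) := by
  simp only [degAt, Finset.mul_sum]
  rw [Finset.sum_comm]
  refine (Finset.sum_le_card_nsmul _ _ (2 * lam + C) fun w hw => ?_).trans ?_
  · have h1 := linkRate_le hlam hn x (Finset.mem_filter.1 hw).2.symm
    have h2 : (linkLoad x.1 s(v, w) : ℝ) ≤ C := by exact_mod_cast x.2 _
    rw [linkRate, Finset.sum_filter] at h1
    rw [linkLoad, Nat.cast_sum, Finset.sum_filter] at h2
    refine le_trans (le_of_eq ?_) (add_le_add h1 h2)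
    rw [← Finset.sum_add_distrib]
    refine Finset.sum_congr rfl fun r _ => ?_
    split_ifs <;> simp
  · rw [nsmul_eq_mul]
    refine mul_le_mul_of_nonneg_right ?_ (by positivity)
    exact_mod_cast (Finset.card_le_univ _).trans_eq (Fintype.card_fin n)

/-- The two-link routes with endpoints `u` and `v`. -/
noncomputable def indirect (u v : Fin n) : Finset (Route n) :=
  Finset.univ.filter fun r => r.ends = s(u, v) ∧ r.mid ≠ none

lemma mem_indirect {u v : Fin n} {r : Route n} :
    r ∈ indirect u v ↔ r.ends = s(u, v) ∧ r.mid ≠ none := by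
  simp [indirect]

/-- Two links sharing the node `w` jump together only through a call between their other ends. This
identifies the cross terms in the product rule with indirect calls between `u` and `v`. -/
lemma mid_eq_of_uses {u v w : Fin n} (huv : u ≠ v) (hwu : w ≠ u) (hwv : w ≠ v) {r : Route n}
    (h1 : r.Uses s(u, w)) (h2 : r.Uses s(v, w)) : r.ends = s(u, v) ∧ r.mid = some w := by
  obtain ⟨e, m, he, hm⟩ := r
  cases m with
  | none =>
    have h1' : s(u, w) = e := h1
    have h2' : s(v, w) = e := h2
    rw [← h2', Sym2.eq_iff] at h1'
    exact absurd h1' (by tauto)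
  | some m =>
    obtain ⟨a, ha, h1⟩ := h1
    obtain ⟨b, hb, h2⟩ := h2
    rw [Sym2.eq_iff] at h1 h2
    obtain ⟨rfl, rfl⟩ : u = a ∧ w = m := by
      rcases h1 with h1 | h1
      · exact h1
      · rcases h2 with h2 | h2
        · exact absurd (h1.1.trans h2.2.symm) hwu.symm
        · exact absurd (h1.1.trans h2.1.symm) huv
    obtain ⟨rfl, -⟩ : v = b ∧ w = w := by
      rcases h2 with h2 | h2
      · exact ⟨h2.1, rfl⟩
      · exact absurd h2.1.symm hwv
    exact ⟨(Sym2.mem_and_mem_iff huv).1 ⟨ha, hb⟩, rfl⟩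

lemma sum_uses_mul_uses_le {u v : Fin n} (huv : u ≠ v) (r : Route n) :
    ∑ w with w ≠ u ∧ w ≠ v,
      ((if r.Uses s(u, w) then 1 else 0) * (if r.Uses s(v, w) then 1 else 0) : ℝ) ≤
      if r ∈ indirect u v then 1 else 0 := by
  have h0 : ∀ w, ((if r.Uses s(u, w) then 1 else 0) * (if r.Uses s(v, w) then 1 else 0) : ℝ) =
      if r.Uses s(u, w) ∧ r.Uses s(v, w) then 1 else 0 := by
    intro w; split_ifs <;> simp_all
  simp only [h0]
  rw [Finset.sum_boole]
  split_ifs with h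
  · have : ((Finset.univ.filter fun w => w ≠ u ∧ w ≠ v).filter fun w =>
        r.Uses s(u, w) ∧ r.Uses s(v, w)).card ≤ 1 := by
      refine Finset.card_le_one.2 fun a ha b hb => ?_
      simp only [Finset.mem_filter, Finset.mem_univ, true_and] at ha hb
      have h1 := (mid_eq_of_uses huv ha.1.1 ha.1.2 ha.2.1 ha.2.2).2
      have h2 := (mid_eq_of_uses huv hb.1.1 hb.1.2 hb.2.1 hb.2.2).2
      exact Option.some.inj (h1.symm.trans h2)
    exact_mod_cast this
  · rw [Nat.cast_nonpos, Finset.card_eq_zero, Finset.filter_eq_empty_iff]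
    rintro w hw ⟨h1, h2⟩
    simp only [Finset.mem_filter, Finset.mem_univ, true_and] at hw
    have h3 := mid_eq_of_uses huv hw.1 hw.2 h1 h2
    exact h (mem_indirect.2 ⟨h3.1, by simp [h3.2]⟩)

/-- There are at most `n - 2` such routes, each of rate at most `lam / (n - 2)`. -/
lemma sum_arrivalRate_indirect_le (hlam : 0 ≤ lam) (hn : 2 < n) (x : Route n → ℕ) {u v : Fin n}
    (huv : u ≠ v) : ∑ r ∈ indirect u v, arrivalRate lam C x r ≤ lam := by
  have h2 : (2 : ℝ) < n := by exact_mod_cast hn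
  have hcard : (indirect u v).card ≤ n - 2 := by
    rw [← card_others huv, ← Finset.card_image_of_injective _ (Option.some_injective (Fin n))]
    refine Finset.card_le_card_of_injOn Route.mid ?_ ?_
    · intro r hr
      have hr := mem_indirect.1 hr
      obtain ⟨w, hw⟩ := Option.ne_none_iff_exists'.1 hr.2
      have := r.mid_ne w hw
      rw [hr.1, Sym2.mem_iff, not_or] at this
      simp only [Finset.coe_image, Set.mem_image, Finset.mem_coe, Finset.mem_filter,
        Finset.mem_univ, true_and]
      exact ⟨w, this, hw.symm⟩
    · intro r hr r' hr' h
      exact Route.ext ((mem_indirect.1 hr).1.trans (mem_indirect.1 hr').1.symm) h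
  have hpos : 0 ≤ lam / ((n : ℝ) - 2) := div_nonneg hlam (by linarith)
  refine (Finset.sum_le_card_nsmul _ _ (lam / ((n : ℝ) - 2)) fun r hr => ?_).trans ?_
  · obtain ⟨w, hw⟩ := Option.ne_none_iff_exists'.1 (mem_indirect.1 hr).2
    simp only [arrivalRate, hw]
    split_ifs
    · exact le_rfl
    · exact hpos
  · rw [nsmul_eq_mul]
    refine (mul_le_mul_of_nonneg_right (show ((indirect u v).card : ℝ) ≤ (n : ℝ) - 2 from ?_)
      hpos).trans_eq ?_
    · have : ((n - 2 : ℕ) : ℝ) = (n : ℝ) - 2 := by rw [Nat.cast_sub hn.le]; simp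
      rw [← this]
      exact_mod_cast hcard
    · field_simp [show (n : ℝ) - 2 ≠ 0 by linarith]

lemma one_le_degAt {u v : Fin n} {r : Route n} (hr : r ∈ indirect u v) :
    1 ≤ degAt u r := by
  obtain ⟨h1, h2⟩ := mem_indirect.1 hr
  obtain ⟨w, hw⟩ := Option.ne_none_iff_exists'.1 h2
  have hwn := r.mid_ne w hw
  rw [h1, Sym2.mem_iff, not_or] at hwn
  have huses : r.Uses s(u, w) := by
    simp only [Route.Uses, hw]
    exact ⟨u, by simp [h1], rfl⟩
  refine le_trans ?_ (Finset.single_le_sum (fun _ _ => by split_ifs <;> simp)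
    (show w ∈ Finset.univ.filter fun w => w ≠ u by simpa using hwn.1))
  simp [huses]

end Links

/-! ### Closeness to a profile, drift of the observables, and size of their jumps -/

section Drift

open scoped Classical

variable {n C : ℕ} {lam : ℝ}

/-- The vector field of the limiting equation with the alternative routing share `c` frozen. -/
noncomputable def linDrift (lam : ℝ) (C : ℕ) (c : ℝ) (y : ℕ → ℝ) (k : ℕ) : ℝ :=
  lam * (1 + c) * ((if 0 < k then y (k - 1) else 0) - (if k < C then y k else 0)) +
    (k + 1) * y (k + 1) - k * y k

lemma linDrift_sum {ι : Type*} (s : Finset ι) (c : ℝ) (y : ι → ℕ → ℝ) (k : ℕ) :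
    linDrift lam C c (fun i => ∑ w ∈ s, y w i) k = ∑ w ∈ s, linDrift lam C c (y w) k := by
  simp only [linDrift, Finset.sum_sub_distrib, Finset.sum_add_distrib, ← Finset.mul_sum]
  split_ifs <;> simp

lemma linDrift_mul (c a : ℝ) (y : ℕ → ℝ) (k : ℕ) :
    linDrift lam C c (fun i => a * y i) k = a * linDrift lam C c y k := by
  simp only [linDrift]
  split_ifs <;> ring

lemma abs_linDrift_sub_le (hlam : 0 ≤ lam) {c c' : ℝ} {y : ℕ → ℝ} (h0 : ∀ i, 0 ≤ y i)
    (h1 : ∀ i, y i ≤ 1) (k : ℕ) :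
    |linDrift lam C c y k - linDrift lam C c' y k| ≤ lam * |c - c'| := by
  have : linDrift lam C c y k - linDrift lam C c' y k =
      lam * (c - c') * ((if 0 < k then y (k - 1) else 0) - (if k < C then y k else 0)) := by
    simp only [linDrift]; ring
  rw [this, abs_mul, abs_mul, abs_of_nonneg hlam]
  refine mul_le_of_le_one_right (by positivity) ?_
  have := h0 (k - 1); have := h0 k; have := h1 (k - 1); have := h1 k
  rw [abs_le]
  split_ifs <;> constructor <;> linarith

/-- Arrivals contribute `2 * lam` times two differences, departures `C + 1` and `C` times one
difference. The value at `C + 1`, not covered by `hyz`, enters for `k = C`; this is what `hC` is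
for. -/
lemma abs_linDrift_sub_linDrift_le (hlam : 0 ≤ lam) {c : ℝ} (hc0 : 0 ≤ c) (hc1 : c ≤ 1)
    {y z : ℕ → ℝ} {B : ℝ} (hyz : ∀ i ≤ C, |y i - z i| ≤ B) (hC : y (C + 1) = z (C + 1)) {k : ℕ}
    (hk : k ≤ C) :
    |linDrift lam C c y k - linDrift lam C c z k| ≤ (4 * lam + 2 * C + 1) * B := by
  have hB : 0 ≤ B := (abs_nonneg _).trans (hyz 0 (Nat.zero_le _))
  have hkC : (k : ℝ) ≤ C := by exact_mod_cast hk
  have e : linDrift lam C c y k - linDrift lam C c z k =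
      lam * (1 + c) * ((if 0 < k then y (k - 1) - z (k - 1) else 0) -
        (if k < C then y k - z k else 0)) +
      ((k + 1) * (y (k + 1) - z (k + 1)) - k * (y k - z k)) := by
    simp only [linDrift]
    split_ifs <;> ring
  have h1 : |(if 0 < k then y (k - 1) - z (k - 1) else 0) - (if k < C then y k - z k else 0)| ≤
      2 * B := by
    refine (abs_sub _ _).trans ?_
    have ha : |(if 0 < k then y (k - 1) - z (k - 1) else 0)| ≤ B := by
      split_ifs
      · exact hyz _ (by omega)
      · simpa using hB
    have hb : |(if k < C then y k - z k else 0)| ≤ B := by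
      split_ifs
      · exact hyz _ hk
      · simpa using hB
    linarith
  have h2 : |y (k + 1) - z (k + 1)| ≤ B := by
    rcases hk.lt_or_eq with h | rfl
    · exact hyz _ h
    · simpa [hC] using hB
  have h3 := hyz k hk
  rw [e]
  refine (abs_add_le _ _).trans ?_
  have h4 : |lam * (1 + c) * ((if 0 < k then y (k - 1) - z (k - 1) else 0) -
      (if k < C then y k - z k else 0))| ≤ lam * 2 * (2 * B) := by
    rw [abs_mul, abs_of_nonneg (mul_nonneg hlam (by linarith))]
    exact mul_le_mul (mul_le_mul_of_nonneg_left (by linarith) hlam) h1 (abs_nonneg _)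
      (by positivity)
  have h5 : |((k : ℝ) + 1) * (y (k + 1) - z (k + 1)) - k * (y k - z k)| ≤ (C + 1) * B + C * B := by
    refine (abs_sub _ _).trans (add_le_add ?_ ?_)
    · rw [abs_mul, abs_of_nonneg (by positivity)]
      exact mul_le_mul (by linarith) h2 (abs_nonneg _) (by positivity)
    · rw [abs_mul, Nat.abs_cast]
      exact mul_le_mul hkC h3 (abs_nonneg _) (by positivity)
  linarith

/-- A full link gains no calls, which matches the cut-off `k < C` in `linDrift`; otherwise the link
gains calls at rate `lam * (1 + altShare)`. -/
lemma genAct_level_eq (x : State n C) {v w : Fin n} (h : v ≠ w) {k : ℕ} (hk : k ≤ C) :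
    genAct lam C (fun y => level y s(v, w) k) x.1 =
      linDrift lam C (altShare C x.1 v w) (level x.1 s(v, w)) k := by
  rw [genAct_level]
  have hl := x.2 s(v, w)
  have h1 : linkRate lam C x.1 s(v, w) *
        ((if linkLoad x.1 s(v, w) + 1 = k then 1 else 0) -
          (if linkLoad x.1 s(v, w) = k then 1 else 0)) =
      lam * (1 + altShare C x.1 v w) * ((if 0 < k then level x.1 s(v, w) (k - 1) else 0) -
        (if k < C then level x.1 s(v, w) k else 0)) := by
    rcases lt_or_ge (linkLoad x.1 s(v, w)) C with hlt | hge
    · rw [linkRate_eq x h hlt]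
      congr 1
      unfold level
      split_ifs <;> first | rfl | (exfalso; omega)
    · rw [linkRate_eq_zero hge, zero_mul]
      unfold level
      split_ifs <;> first | (exfalso; omega) | simp
  rw [h1, linDrift, add_sub_assoc]
  congr 1
  unfold level
  split_ifs with h2 h3 h3
  · omega
  · rw [h2]; push_cast; ring
  · rw [h3]; ring
  · simp

/-- The number of links at `v` with load `k`. -/
noncomputable def starCount (v : Fin n) (k : ℕ) (x : Route n → ℕ) : ℝ :=
  ∑ w with w ≠ v, level x s(v, w) k

/-- The number of nodes `w` whose links to `u` and `v` have loads `j` and `k`. -/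
noncomputable def pairCount (u v : Fin n) (j k : ℕ) (x : Route n → ℕ) : ℝ :=
  ∑ w with w ≠ u ∧ w ≠ v, level x s(u, w) j * level x s(v, w) k

/-- The number of indirectly routed calls between `u` and `v`. -/
noncomputable def indirectCount (u v : Fin n) (x : Route n → ℕ) : ℝ :=
  ∑ r ∈ indirect u v, (x r : ℝ)

lemma sum_level_others (x : Route n → ℕ) {v w : Fin n} (h : w ≠ v) (k : ℕ) :
    ∑ z with z ≠ v ∧ z ≠ w, level x s(v, z) k = starCount v k x - level x s(v, w) k := by
  have : (Finset.univ.filter fun z : Fin n => z ≠ v ∧ z ≠ w) =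
      (Finset.univ.filter fun z => z ≠ v).erase w := by
    ext; simp [and_comm]
  rw [this, starCount, Finset.sum_erase_eq_sub (by simpa using h)]

/-- This identity is the reason for tracking pair counts. The subtracted levels account for the link
`{v, w}`, which the star counts include and the share does not. -/
lemma altShare_eq (x : Route n → ℕ) {v w : Fin n} (h : v ≠ w) :
    altShare C x v w = 1 / ((n : ℝ) - 2) * ((starCount v C x - level x s(v, w) C) +
      (starCount w C x - level x s(w, v) C) - 2 * pairCount v w C C x) := by
  rw [altShare, ← sum_level_others x h.symm, ← sum_level_others x h, pairCount]
  congr 1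
  have : (Finset.univ.filter fun z : Fin n => z ≠ w ∧ z ≠ v) =
      Finset.univ.filter fun z => z ≠ v ∧ z ≠ w := by
    ext; simp [and_comm]
  rw [this, Finset.mul_sum, ← Finset.sum_add_distrib, ← Finset.sum_sub_distrib]
  refine Finset.sum_congr rfl fun z _ => ?_
  ring

/-- The load vector `x` is within `E` of the profile `ζ`. -/
structure CloseTo (C : ℕ) (ζ : ℕ → ℝ) (E : ℝ) (x : Route n → ℕ) : Prop where
  star : ∀ v, ∀ k ≤ C, |starCount v k x - ((n : ℝ) - 1) * ζ k| ≤ E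
  -- With the factor 2, an error `E` in each factor of a product is allowed, and a single growth
  -- rate serves all three families in the Gronwall argument.
  pair : ∀ u v, u ≠ v → ∀ j ≤ C, ∀ k ≤ C,
    |pairCount u v j k x - ((n : ℝ) - 2) * (ζ j * ζ k)| ≤ 2 * E
  indirect_le : ∀ u v, u ≠ v → indirectCount u v x ≤ 2 * E

/-- A sub-probability vector on the possible loads. -/
structure IsProfile (C : ℕ) (ζ : ℕ → ℝ) : Prop where
  nonneg : ∀ k, 0 ≤ ζ k
  le_one : ∀ k, ζ k ≤ 1
  eq_zero : ∀ k, C < k → ζ k = 0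

/-- The limiting alternative routing share. -/
noncomputable def share (C : ℕ) (ζ : ℕ → ℝ) : ℝ := 2 * ζ C * (1 - ζ C)

lemma IsProfile.share_nonneg {ζ : ℕ → ℝ} (h : IsProfile C ζ) : 0 ≤ share C ζ :=
  mul_nonneg (by linarith [h.nonneg C]) (by linarith [h.le_one C])

lemma share_le_one (ζ : ℕ → ℝ) : share C ζ ≤ 1 := by
  unfold share
  nlinarith [sq_nonneg (2 * ζ C - 1)]

/-- In `6 * E + 2`, the two star counts give `2E`, twice the pair count gives `4E`, and the link
`{v, w}`, seen from both ends, gives 2. -/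
lemma CloseTo.abs_altShare_sub_le {ζ : ℕ → ℝ} (hζ : IsProfile C ζ) {E : ℝ} {x : Route n → ℕ}
    (h : CloseTo C ζ E x) (hn : 2 < n) {v w : Fin n} (hvw : v ≠ w) :
    |altShare C x v w - share C ζ| ≤ (6 * E + 2) / ((n : ℝ) - 2) := by
  have h2 : (0 : ℝ) < (n : ℝ) - 2 := by
    have : (2 : ℝ) < n := by exact_mod_cast hn
    linarith
  have e : altShare C x v w - share C ζ = ((starCount v C x - ((n : ℝ) - 1) * ζ C) +
      (starCount w C x - ((n : ℝ) - 1) * ζ C) -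
      2 * (pairCount v w C C x - ((n : ℝ) - 2) * (ζ C * ζ C)) + (ζ C - level x s(v, w) C) +
      (ζ C - level x s(w, v) C)) / ((n : ℝ) - 2) := by
    rw [altShare_eq x hvw, share]
    field_simp
    ring
  rw [e, abs_div, abs_of_pos h2]
  refine div_le_div_of_nonneg_right ?_ h2.le
  have h3 := abs_le.1 (h.star v C le_rfl)
  have h4 := abs_le.1 (h.star w C le_rfl)
  have h5 := abs_le.1 (h.pair v w hvw C le_rfl C le_rfl)
  have := hζ.nonneg C
  have := hζ.le_one C
  have := level_nonneg x s(v, w) C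
  have := level_le_one x s(v, w) C
  have := level_nonneg x s(w, v) C
  have := level_le_one x s(w, v) C
  rw [abs_le]
  constructor <;> linarith

lemma level_eq_zero (x : State n C) (e : Sym2 (Fin n)) {k : ℕ} (hk : C < k) : level x.1 e k = 0 := by
  have := x.2 e
  rw [level, if_neg (by omega)]

lemma abs_linDrift_level_sub_le (hlam : 0 ≤ lam) {ζ : ℕ → ℝ} (hζ : IsProfile C ζ) {E : ℝ}
    {x : Route n → ℕ} (h : CloseTo C ζ E x) (hn : 2 < n) {v w : Fin n} (hvw : v ≠ w) (k : ℕ) :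
    |linDrift lam C (altShare C x v w) (level x s(v, w)) k -
      linDrift lam C (share C ζ) (level x s(v, w)) k| ≤ lam * ((6 * E + 2) / ((n : ℝ) - 2)) :=
  (abs_linDrift_sub_le hlam (level_nonneg _ _) (level_le_one _ _) k).trans
    (mul_le_mul_of_nonneg_left (h.abs_altShare_sub_le hζ hn hvw) hlam)

/-- Replacing each `altShare` by the common limit `share` costs `2 * lam * (6 * E + 2)`, since
`(n-1)/(n-2) ≤ 2`. The drift is then linear in the star counts, and its Lipschitz bound gives the
remaining `(4 * lam + 2 * C + 1) * E`. -/
lemma CloseTo.abs_genAct_starCount_sub_le (hlam : 0 ≤ lam) (hn : 2 < n) {ζ : ℕ → ℝ}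
    (hζ : IsProfile C ζ) {E : ℝ} {x : State n C} (h : CloseTo C ζ E x.1) (v : Fin n) {k : ℕ}
    (hk : k ≤ C) :
    |genAct lam C (starCount v k) x.1 - ((n : ℝ) - 1) * linDrift lam C (share C ζ) ζ k| ≤
      (16 * lam + 2 * C + 1) * E + 4 * lam := by
  have h3 : (3 : ℝ) ≤ n := by exact_mod_cast hn
  have hE : 0 ≤ E := (abs_nonneg _).trans (h.star v k hk)
  have e1 : genAct lam C (starCount v k) x.1 =
      ∑ w with w ≠ v, linDrift lam C (altShare C x.1 v w) (level x.1 s(v, w)) k := by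
    rw [show starCount v k = fun x : Route n → ℕ => ∑ w with w ≠ v, level x s(v, w) k from rfl,
      genAct_sum]
    exact Finset.sum_congr rfl fun w hw => genAct_level_eq x (Finset.mem_filter.1 hw).2.symm hk
  have e2 : |genAct lam C (starCount v k) x.1 -
      linDrift lam C (share C ζ) (fun i => starCount v i x.1) k| ≤ 2 * lam * (6 * E + 2) := by
    simp only [starCount]
    rw [linDrift_sum, e1, ← Finset.sum_sub_distrib]
    refine (Finset.abs_sum_le_sum_abs _ _).trans ((Finset.sum_le_card_nsmul _ _ _ fun w hw =>
      abs_linDrift_level_sub_le hlam hζ h hn (Finset.mem_filter.1 hw).2.symm k).trans ?_)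
    have hcard : (Finset.univ.filter fun w : Fin n => w ≠ v).card = n - 1 := by
      rw [Finset.filter_ne', Finset.card_erase_of_mem (Finset.mem_univ _)]; simp
    rw [hcard, nsmul_eq_mul, Nat.cast_sub (by omega), Nat.cast_one]
    have : ((n : ℝ) - 1) / ((n : ℝ) - 2) ≤ 2 := by
      rw [div_le_iff₀ (by linarith)]; linarith
    calc ((n : ℝ) - 1) * (lam * ((6 * E + 2) / ((n : ℝ) - 2)))
        = ((n : ℝ) - 1) / ((n : ℝ) - 2) * (lam * (6 * E + 2)) := by ring
      _ ≤ 2 * (lam * (6 * E + 2)) := mul_le_mul_of_nonneg_right this (by positivity)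
      _ = _ := by ring
  have e3 := abs_linDrift_sub_linDrift_le hlam hζ.share_nonneg (share_le_one ζ)
    (y := fun i => starCount v i x.1) (z := fun i => ((n : ℝ) - 1) * ζ i) (h.star v)
    (by simp [starCount, level_eq_zero, hζ.eq_zero]) hk
  rw [linDrift_mul] at e3
  have := (abs_sub_le _ _ _).trans (add_le_add e2 e3)
  refine this.trans (le_of_eq ?_)
  ring

/-- The constant adds up three errors: `lam + 2 * E` from joint jumps (arrivals and departures of
indirect calls between `u` and `v`), `2 * lam * (6 * E + 2)` from freezing the share, and `2 * (4 *
lam + 2 * C + 1) * (2 * E)` from the Lipschitz bound in each of the two indices. -/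
lemma CloseTo.abs_genAct_pairCount_sub_le (hlam : 0 ≤ lam) (hn : 2 < n) {ζ : ℕ → ℝ}
    (hζ : IsProfile C ζ) {E : ℝ} {x : State n C} (h : CloseTo C ζ E x.1) {u v : Fin n}
    (huv : u ≠ v) {j k : ℕ} (hj : j ≤ C) (hk : k ≤ C) :
    |genAct lam C (pairCount u v j k) x.1 - ((n : ℝ) - 2) *
      (linDrift lam C (share C ζ) ζ j * ζ k + ζ j * linDrift lam C (share C ζ) ζ k)| ≤
      (28 * lam + 8 * C + 6) * E + 5 * lam := by
  have h3 : (3 : ℝ) ≤ n := by exact_mod_cast hn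
  have hE : 0 ≤ E := (abs_nonneg _).trans (h.star v k hk)
  set τ := share C ζ with hτ
  set s := Finset.univ.filter fun w : Fin n => w ≠ u ∧ w ≠ v with hs
  have hmem : ∀ w ∈ s, u ≠ w ∧ v ≠ w := fun w hw =>
    ⟨(Finset.mem_filter.1 hw).2.1.symm, (Finset.mem_filter.1 hw).2.2.symm⟩
  have hcard : (s.card : ℝ) = (n : ℝ) - 2 := by
    rw [hs, card_others huv, Nat.cast_sub hn.le]; simp
  have e0 : |genAct lam C (pairCount u v j k) x.1 -
      ∑ w ∈ s, (genAct lam C (fun y => level y s(u, w) j) x.1 * level x.1 s(v, w) k +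
        level x.1 s(u, w) j * genAct lam C (fun y => level y s(v, w) k) x.1)| ≤ lam + 2 * E := by
    rw [show pairCount u v j k = fun x : Route n → ℕ =>
      ∑ w ∈ s, level x s(u, w) j * level x s(v, w) k from rfl, genAct_sum,
      ← Finset.sum_sub_distrib]
    refine (Finset.abs_sum_le_sum_abs _ _).trans ((Finset.sum_le_sum fun w _ =>
      abs_genAct_level_mul_sub_le hlam hn x.1 _ _ j k).trans ?_)
    rw [Finset.sum_comm]
    calc _ ≤ ∑ r, (arrivalRate lam C x.1 r + x.1 r) * (if r ∈ indirect u v then 1 else 0) := by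
          refine Finset.sum_le_sum fun r _ => ?_
          rw [← Finset.mul_sum]
          exact mul_le_mul_of_nonneg_left (sum_uses_mul_uses_le huv r)
            (add_nonneg (arrivalRate_nonneg hlam hn _ _) (Nat.cast_nonneg _))
      _ = ∑ r ∈ indirect u v, arrivalRate lam C x.1 r + indirectCount u v x.1 := by
          rw [indirectCount, ← Finset.sum_add_distrib]
          simp
      _ ≤ _ := add_le_add (sum_arrivalRate_indirect_le hlam hn _ huv) (h.indirect_le u v huv)
  have e1 : |∑ w ∈ s, (genAct lam C (fun y => level y s(u, w) j) x.1 * level x.1 s(v, w) k +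
        level x.1 s(u, w) j * genAct lam C (fun y => level y s(v, w) k) x.1) -
      ∑ w ∈ s, (linDrift lam C τ (level x.1 s(u, w)) j * level x.1 s(v, w) k +
        level x.1 s(u, w) j * linDrift lam C τ (level x.1 s(v, w)) k)| ≤
      2 * lam * (6 * E + 2) := by
    rw [← Finset.sum_sub_distrib]
    refine (Finset.abs_sum_le_sum_abs _ _).trans ((Finset.sum_le_card_nsmul _ _
      (2 * (lam * ((6 * E + 2) / ((n : ℝ) - 2)))) fun w hw => ?_).trans (le_of_eq ?_))
    · rw [genAct_level_eq x (hmem w hw).1 hj, genAct_level_eq x (hmem w hw).2 hk]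
      have h1 := abs_linDrift_level_sub_le hlam hζ h hn (hmem w hw).1 j
      have h2 := abs_linDrift_level_sub_le hlam hζ h hn (hmem w hw).2 k
      rw [← hτ] at h1 h2
      rw [show ∀ a b c d p q : ℝ, a * b + c * d - (p * b + c * q) = (a - p) * b + c * (d - q) from
        fun _ _ _ _ _ _ => by ring]
      refine (abs_add_le _ _).trans ?_
      rw [abs_mul, abs_mul, abs_of_nonneg (level_nonneg _ _ _), abs_of_nonneg (level_nonneg _ _ _),
        two_mul]
      exact add_le_add ((mul_le_of_le_one_right (abs_nonneg _) (level_le_one _ _ _)).trans h1)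
        ((mul_le_of_le_one_left (abs_nonneg _) (level_le_one _ _ _)).trans h2)
    · rw [nsmul_eq_mul, hcard]
      field_simp [show (n : ℝ) - 2 ≠ 0 by linarith]
  have e2 : ∑ w ∈ s, (linDrift lam C τ (level x.1 s(u, w)) j * level x.1 s(v, w) k +
        level x.1 s(u, w) j * linDrift lam C τ (level x.1 s(v, w)) k) =
      linDrift lam C τ (fun i => pairCount u v i k x.1) j +
        linDrift lam C τ (fun i => pairCount u v j i x.1) k := by
    rw [Finset.sum_add_distrib]
    simp only [pairCount]
    rw [linDrift_sum, linDrift_sum]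
    congr 1
    · refine Finset.sum_congr rfl fun w _ => ?_
      rw [mul_comm, ← linDrift_mul]
      simp only [mul_comm]
    · refine Finset.sum_congr rfl fun w _ => ?_
      rw [← linDrift_mul]
  have e3 := abs_linDrift_sub_linDrift_le hlam hζ.share_nonneg (share_le_one ζ)
    (y := fun i => pairCount u v i k x.1) (z := fun i => (((n : ℝ) - 2) * ζ k) * ζ i) (B := 2 * E)
    (fun i hi => by
      have := h.pair u v huv i hi k hk
      rwa [mul_comm (ζ i), ← mul_assoc] at this)
    (by simp [pairCount, level_eq_zero, hζ.eq_zero]) hj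
  have e4 := abs_linDrift_sub_linDrift_le hlam hζ.share_nonneg (share_le_one ζ)
    (y := fun i => pairCount u v j i x.1) (z := fun i => (((n : ℝ) - 2) * ζ j) * ζ i) (B := 2 * E)
    (fun i hi => by
      have := h.pair u v huv j hj i hi
      rwa [← mul_assoc] at this)
    (by simp [pairCount, level_eq_zero, hζ.eq_zero]) hk
  rw [linDrift_mul, ← hτ] at e3 e4
  rw [e2] at e1
  have a0 := abs_le.1 e0
  have a1 := abs_le.1 e1
  have a3 := abs_le.1 e3
  have a4 := abs_le.1 e4
  rw [abs_le]
  constructor <;> linarith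

/-- Departures only lower the count and are discarded; an upper bound is all that `CloseTo` asks
for. -/
lemma genAct_indirectCount_le (hlam : 0 ≤ lam) (hn : 2 < n) (x : Route n → ℕ) {u v : Fin n}
    (huv : u ≠ v) : genAct lam C (indirectCount u v) x ≤ lam := by
  refine le_trans ?_ (sum_arrivalRate_indirect_le (C := C) hlam hn x huv)
  rw [genAct, ← Finset.sum_filter_add_sum_filter_not _ (· ∈ indirect u v)]
  have h1 : ∀ r, indirectCount u v (x + Pi.single r 1) - indirectCount u v x =
      if r ∈ indirect u v then 1 else 0 := by
    intro r
    simp only [indirectCount, ← Finset.sum_sub_distrib, Pi.add_apply, Nat.cast_add,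
      add_sub_cancel_left, Pi.single_apply]
    simp
  have h2 : ∀ r, indirectCount u v (x - Pi.single r 1) - indirectCount u v x ≤ 0 := by
    intro r
    rw [sub_nonpos]
    exact Finset.sum_le_sum fun s _ => by simp
  have h3 : ∀ r ∉ indirect u v, indirectCount u v (x - Pi.single r 1) - indirectCount u v x = 0 := by
    intro r hr
    rw [sub_eq_zero]
    refine Finset.sum_congr rfl fun s hs => ?_
    have : s ≠ r := fun h => hr (h ▸ hs)
    simp [this]
  have h4 : ∑ r with r ∉ indirect u v,
      (arrivalRate lam C x r * (indirectCount u v (x + Pi.single r 1) - indirectCount u v x) +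
        x r * (indirectCount u v (x - Pi.single r 1) - indirectCount u v x)) = 0 := by
    refine Finset.sum_eq_zero fun r hr => ?_
    have := (Finset.mem_filter.1 hr).2
    rw [h1, h3 r this, if_neg this]
    simp
  rw [h4, add_zero]
  have : (Finset.univ.filter fun r => r ∈ indirect u v) = indirect u v := by ext; simp
  rw [this]
  refine Finset.sum_le_sum fun r hr => ?_
  rw [h1, if_pos hr]
  have := mul_nonpos_of_nonneg_of_nonpos (Nat.cast_nonneg (α := ℝ) (x r)) (h2 r)
  linarith

/-- A jump along the route `r` changes `g` by at most the number of links of `r` at `u` and `v`. -/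
structure JumpBound (u v : Fin n) (g : (Route n → ℕ) → ℝ) : Prop where
  add : ∀ x r, |g (x + Pi.single r 1) - g x| ≤ degAt u r + degAt v r
  sub : ∀ x r, x r ≠ 0 → |g (x - Pi.single r 1) - g x| ≤ degAt u r + degAt v r

/-- A departure from `x` is an arrival at `x - Pi.single r 1` reversed. -/
lemma JumpBound.of_add {u v : Fin n} {g : (Route n → ℕ) → ℝ}
    (h : ∀ x r, |g (x + Pi.single r 1) - g x| ≤ degAt u r + degAt v r) : JumpBound u v g where
  add := h
  sub x r hr := by
    have := h (x - Pi.single r 1) r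
    rwa [sub_single_add_single hr, abs_sub_comm] at this

lemma JumpBound.neg {u v : Fin n} {g : (Route n → ℕ) → ℝ} (h : JumpBound u v g) :
    JumpBound u v (fun x => -g x) :=
  .of_add fun x r => by
    rw [neg_sub_neg, abs_sub_comm]
    exact h.add x r

lemma jumpBound_starCount (v : Fin n) (k : ℕ) : JumpBound v v (starCount v k) := by
  refine .of_add fun x r => ?_
  have : |starCount v k (x + Pi.single r 1) - starCount v k x| ≤ degAt v r := by
    rw [starCount, starCount, ← Finset.sum_sub_distrib]
    exact (Finset.abs_sum_le_sum_abs _ _).trans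
      (Finset.sum_le_sum fun w _ => abs_level_add_single _ _ _ _)
  linarith [degAt_nonneg v r]

lemma jumpBound_pairCount (u v : Fin n) (j k : ℕ) : JumpBound u v (pairCount u v j k) := by
  refine .of_add fun x r => ?_
  rw [pairCount, pairCount, ← Finset.sum_sub_distrib]
  refine (Finset.abs_sum_le_sum_abs _ _).trans ?_
  calc _ ≤ ∑ w with w ≠ u ∧ w ≠ v, (((if r.Uses s(u, w) then 1 else 0) : ℝ) +
        (if r.Uses s(v, w) then 1 else 0)) := by
        refine Finset.sum_le_sum fun w _ => ?_
        rw [show ∀ a b c d : ℝ, a * b - c * d = (a - c) * b + c * (b - d) from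
          fun _ _ _ _ => by ring]
        refine (abs_add_le _ _).trans ?_
        rw [abs_mul, abs_mul, abs_of_nonneg (level_nonneg _ _ _),
          abs_of_nonneg (level_nonneg _ _ _)]
        exact add_le_add ((mul_le_of_le_one_right (abs_nonneg _) (level_le_one _ _ _)).trans
          (abs_level_add_single _ _ _ _))
          ((mul_le_of_le_one_left (abs_nonneg _) (level_le_one _ _ _)).trans
          (abs_level_add_single _ _ _ _))
    _ ≤ _ := by
        rw [Finset.sum_add_distrib]
        refine add_le_add ?_ ?_
        · exact Finset.sum_le_sum_of_subset_of_nonneg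
            (fun w hw => by simp at hw ⊢; exact hw.1) fun _ _ _ => by split_ifs <;> simp
        · exact Finset.sum_le_sum_of_subset_of_nonneg
            (fun w hw => by simp at hw ⊢; exact hw.2) fun _ _ _ => by split_ifs <;> simp

lemma jumpBound_indirectCount (u v : Fin n) : JumpBound u v (indirectCount u v) := by
  refine .of_add fun x r => ?_
  have h1 : indirectCount u v (x + Pi.single r 1) - indirectCount u v x =
      if r ∈ indirect u v then 1 else 0 := by
    simp only [indirectCount, ← Finset.sum_sub_distrib, Pi.add_apply, Nat.cast_add,
      add_sub_cancel_left, Pi.single_apply]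
    simp
  have := degAt_nonneg u r
  have := degAt_nonneg v r
  rw [h1]
  split_ifs with h
  · have := one_le_degAt h
    simp; linarith
  · simp; linarith

lemma JumpBound.abs_sub_le {u v : Fin n} {g : (Route n → ℕ) → ℝ} (h : JumpBound u v g)
    {x y : State n C} (hxy : x ≠ y) (hq : generator n C lam x y ≠ 0) : |g y.1 - g x.1| ≤ 4 := by
  obtain ⟨r, hr⟩ := exists_of_generator_ne_zero hxy hq
  have := degAt_le_two u r
  have := degAt_le_two v r
  rcases hr with hr | ⟨hr0, hr⟩
  · rw [hr]
    linarith [h.add x.1 r]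
  · rw [hr]
    linarith [h.sub x.1 r hr0]

/-- A jump `a` has `|a| ≤ degAt u r + degAt v r ≤ 4`, so its square is at most 4 times that sum.
Each of the two nodes then contributes `4 * n * (2 * lam + C)`. -/
lemma JumpBound.sum_generator_mul_sq_le {u v : Fin n} {g : (Route n → ℕ) → ℝ}
    (h : JumpBound u v g) (hlam : 0 ≤ lam) (hn : 2 < n) (x : State n C) :
    ∑ y, generator n C lam x y * (g y.1 - g x.1) ^ 2 ≤ 8 * n * (2 * lam + C) := by
  rw [sum_generator_mul x (ψ := fun y => (g y - g x.1) ^ 2) (by simp)]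
  have hd : ∀ (r : Route n) (a : ℝ), |a| ≤ degAt u r + degAt v r →
      a ^ 2 ≤ 4 * (degAt u r + degAt v r) := by
    intro r a ha
    have := degAt_le_two u r
    have := degAt_le_two v r
    rw [← sq_abs]
    nlinarith [abs_nonneg a]
  calc _ ≤ ∑ r, (4 * ((arrivalRate lam C x.1 r + x.1 r) * degAt u r) +
        4 * ((arrivalRate lam C x.1 r + x.1 r) * degAt v r)) := by
        refine Finset.sum_le_sum fun r _ => ?_
        have h1 := mul_le_mul_of_nonneg_left (hd r _ (h.add x.1 r))
          (arrivalRate_nonneg (C := C) hlam hn x.1 r)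
        have h2 : (x.1 r : ℝ) * (g (x.1 - Pi.single r 1) - g x.1) ^ 2 ≤
            x.1 r * (4 * (degAt u r + degAt v r)) := by
          by_cases hr : x.1 r = 0
          · simp [hr]
          · exact mul_le_mul_of_nonneg_left (hd r _ (h.sub x.1 r hr)) (Nat.cast_nonneg _)
        linarith
    _ ≤ _ := by
        rw [Finset.sum_add_distrib, ← Finset.mul_sum, ← Finset.mul_sum]
        linarith [sum_rate_mul_degAt_le hlam hn x u, sum_rate_mul_degAt_le hlam hn x v]

end Drift

/-! ### The limiting equation: existence, invariance of the simplex, uniqueness, Euler steps -/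

section Solution

variable {C : ℕ} {lam : ℝ}

/-- The extension of `ξ` by zero to all loads. -/
def profile (ξ : Fin (C + 1) → ℝ) (k : ℕ) : ℝ := if h : k < C + 1 then ξ ⟨k, h⟩ else 0

lemma profile_coe (ξ : Fin (C + 1) → ℝ) (k : Fin (C + 1)) : profile ξ k = ξ k := by
  simp only [profile, k.isLt, dif_pos]

lemma drift_eq_linDrift (ξ : Fin (C + 1) → ℝ) (k : Fin (C + 1)) :
    drift C lam ξ k = linDrift lam C (share C (profile ξ)) (profile ξ) k := by
  obtain ⟨k, hk⟩ := k
  have hC : profile ξ C = ξ (Fin.last C) := by simp [profile, Fin.last]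
  have hk1 : k - 1 < C + 1 := by omega
  simp only [drift, linDrift, share, altRate, hC]
  by_cases h : k < C
  · have h' : k + 1 < C + 1 := by omega
    simp only [profile, hk, hk1, h', h, dif_pos, if_true]
    split_ifs <;> ring
  · have h' : ¬ k + 1 < C + 1 := by omega
    simp only [profile, hk, hk1, h', h, dif_pos, if_false, dif_neg, not_false_eq_true]
    split_ifs <;> ring

/-- Conservation of mass: the arrival and departure fluxes both telescope. -/
lemma sum_linDrift (c : ℝ) {y : ℕ → ℝ} (hy : y (C + 1) = 0) :
    ∑ k ∈ Finset.range (C + 1), linDrift lam C c y k = 0 := by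
  simp only [linDrift, add_sub_assoc]
  rw [Finset.sum_add_distrib, ← Finset.mul_sum, Finset.sum_sub_distrib]
  have h1 : ∑ k ∈ Finset.range (C + 1), (if 0 < k then y (k - 1) else 0) =
      ∑ k ∈ Finset.range C, y k := by
    rw [Finset.sum_range_succ']
    simp
  have h2 : ∑ k ∈ Finset.range (C + 1), (if k < C then y k else 0) =
      ∑ k ∈ Finset.range C, y k := by
    rw [Finset.sum_range_succ]
    simp only [lt_irrefl, if_false, add_zero]
    exact Finset.sum_congr rfl fun k hk => if_pos (Finset.mem_range.1 hk)
  have h3 : ∑ k ∈ Finset.range (C + 1), (((k : ℝ) + 1) * y (k + 1) - k * y k) = 0 := by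
    have := Finset.sum_range_sub (fun k : ℕ => (k : ℝ) * y k) (C + 1)
    simpa [hy] using this
  rw [h1, h2, h3]
  simp

lemma sum_drift (ξ : Fin (C + 1) → ℝ) : ∑ k, drift C lam ξ k = 0 := by
  simp only [drift_eq_linDrift]
  rw [Fin.sum_univ_eq_sum_range (fun k => linDrift lam C (share C (profile ξ)) (profile ξ) k)]
  exact sum_linDrift _ (by simp [profile])

/-- Every outflow from load `k` carries the factor `ξ k`; only inflow remains on that face of the
cube. -/
lemma drift_nonneg_of_eq_zero (hlam : 0 ≤ lam) {ξ : Fin (C + 1) → ℝ} (h0 : ∀ k, 0 ≤ ξ k)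
    (h1 : ∀ k, ξ k ≤ 1) {k : Fin (C + 1)} (hk : ξ k = 0) : 0 ≤ drift C lam ξ k := by
  have ha : ∀ j, 0 ≤ altRate ξ j := fun j => by
    unfold altRate
    have := h0 (Fin.last C)
    have := h1 (Fin.last C)
    exact mul_nonneg (mul_nonneg (by linarith) (by linarith)) (h0 j)
  have hak : altRate ξ k = 0 := by simp [altRate, hk]
  unfold drift
  rw [hk, hak]
  simp only [mul_zero, neg_zero, sub_zero, zero_add]
  refine add_nonneg ?_ ?_ <;> split_ifs
  · exact add_nonneg (mul_nonneg hlam (h0 _)) (mul_nonneg hlam (ha _))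
  · exact le_rfl
  · exact mul_nonneg (by positivity) (h0 _)
  · exact le_rfl

lemma contDiff_drift : ContDiff ℝ 1 (drift C lam) := by
  refine contDiff_pi.2 fun k => ?_
  unfold drift altRate
  split_ifs <;> fun_prop

/-- The coordinatewise projection onto the unit cube. -/
def clamp (ξ : Fin (C + 1) → ℝ) (k : Fin (C + 1)) : ℝ := max 0 (min 1 (ξ k))

lemma clamp_nonneg (ξ : Fin (C + 1) → ℝ) (k : Fin (C + 1)) : 0 ≤ clamp ξ k := le_max_left _ _

lemma clamp_le_one (ξ : Fin (C + 1) → ℝ) (k : Fin (C + 1)) : clamp ξ k ≤ 1 :=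
  max_le zero_le_one (min_le_left _ _)

lemma lipschitzWith_clamp : LipschitzWith 1 (clamp (C := C)) := by
  refine LipschitzWith.of_dist_le_mul fun ξ η => ?_
  refine (dist_pi_le_iff (by positivity)).2 fun k => ?_
  exact (((LipschitzWith.eval k).const_min 1).const_max 0).dist_le_mul ξ η

lemma clamp_eq_self {ξ : Fin (C + 1) → ℝ} (h0 : ∀ k, 0 ≤ ξ k) (h1 : ∀ k, ξ k ≤ 1) :
    clamp ξ = ξ := by
  funext k
  simp [clamp, h0 k, h1 k]

/-- The polynomial field is Lipschitz and bounded on the cube. Composing it with the projection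
makes these bounds global, so a single Picard-Lindelöf step covers the whole of `[0, t₀]`. -/
lemma exists_lipschitzWith_drift_clamp :
    ∃ K L : ℝ≥0, LipschitzWith K (fun ξ => drift C lam (clamp ξ)) ∧
      ∀ ξ, ‖drift C lam (clamp ξ)‖ ≤ L := by
  have hcube : IsCompact (Icc (0 : Fin (C + 1) → ℝ) 1) := isCompact_Icc
  have hmem : ∀ ξ, clamp ξ ∈ Icc (0 : Fin (C + 1) → ℝ) 1 := fun ξ =>
    ⟨clamp_nonneg ξ, clamp_le_one ξ⟩
  obtain ⟨K, hK⟩ := (contDiff_drift (C := C) (lam := lam)).contDiffOn.exists_lipschitzOnWith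
    one_ne_zero (convex_Icc _ _) hcube
  obtain ⟨L, hL⟩ := hcube.exists_bound_of_continuousOn
    (contDiff_drift (C := C) (lam := lam)).continuous.continuousOn
  refine ⟨K, L.toNNReal, fun ξ η => ?_, fun ξ => (hL _ (hmem ξ)).trans (Real.le_coe_toNNReal L)⟩
  refine (hK (hmem ξ) (hmem η)).trans ?_
  refine mul_le_mul_right ?_ _
  simpa using lipschitzWith_clamp ξ η

lemma hasDerivWithinAt_Ici_of_Icc {E : Type*} [NormedAddCommGroup E] [NormedSpace ℝ E] {f : ℝ → E}
    {f' : E} {a b t : ℝ} (h : HasDerivWithinAt f f' (Icc a b) t) (ht : t ∈ Ico a b) :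
    HasDerivWithinAt f f' (Ici t) t :=
  h.mono_of_mem_nhdsWithin (Icc_mem_nhdsGE_of_mem ht)

lemma exists_isSolution (hlam : 0 ≤ lam) {t₀ : ℝ} (ht₀ : 0 ≤ t₀) {ξ₀ : Fin (C + 1) → ℝ}
    (hξ₀ : ξ₀ ∈ stdSimplex ℝ (Fin (C + 1))) :
    ∃ ξ, IsSolution C lam t₀ ξ₀ ξ ∧ ∀ t ∈ Icc 0 t₀, ξ t ∈ stdSimplex ℝ (Fin (C + 1)) := by
  obtain ⟨K, L, hK, hL⟩ := exists_lipschitzWith_drift_clamp (C := C) (lam := lam)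
  have hpl : IsPicardLindelof (fun _ ξ => drift C lam (clamp ξ)) (tmin := 0) (tmax := t₀)
      ⟨0, le_rfl, ht₀⟩ ξ₀ (L * t₀.toNNReal) 0 L K :=
    { lipschitzOnWith := fun _ _ => hK.lipschitzOnWith
      continuousOn := fun _ _ => continuousOn_const
      norm_le := fun _ _ ξ _ => hL ξ
      mul_max_le := by simp [ht₀] }
  obtain ⟨ξ, h0, hξ⟩ := hpl.exists_eq_forall_mem_Icc_hasDerivWithinAt₀
  simp only at h0
  have hk : ∀ k, ∀ t ∈ Icc 0 t₀, HasDerivWithinAt (fun t => ξ t k) (drift C lam (clamp (ξ t)) k)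
      (Icc 0 t₀) t := fun k t ht => hasDerivWithinAt_pi.1 (hξ t ht) k
  have hcont : ∀ k, ContinuousOn (fun t => ξ t k) (Icc 0 t₀) := fun k t ht =>
    (hk k t ht).continuousWithinAt
  have hnn : ∀ t ∈ Icc 0 t₀, ∀ k, 0 ≤ ξ t k := by
    intro t ht k
    by_contra! hneg
    -- The function `-ξ · k` cannot cross the barrier `ε (1 + t)`: at a contact the coordinate is
    -- negative, its clamp is 0, and the drift is non-negative, so `-ξ · k` has slope at most `0 <
    -- ε`. A suitable `ε` then contradicts `ξ t k < 0`.
    have key : ∀ ε > 0, -ξ t k ≤ ε * (1 + t) := by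
      intro ε hε
      refine image_le_of_deriv_right_lt_deriv_boundary' (f := fun t => -ξ t k)
        (f' := fun t => -drift C lam (clamp (ξ t)) k) (B := fun t => ε * (1 + t))
        (B' := fun _ => ε) (hcont k).neg
        (fun s hs => hasDerivWithinAt_Ici_of_Icc (hk k s (Ico_subset_Icc_self hs)).neg hs) ?_ (by fun_prop) ?_ ?_ ht
      · simp only [h0]
        linarith [hξ₀.1 k]
      · intro s _
        have := ((hasDerivAt_id s).const_add 1).const_mul ε
        simpa using this.hasDerivWithinAt
      · intro s hs heq
        have hs0 : 0 < ε * (1 + s) := mul_pos hε (by linarith [hs.1])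
        have hcl : clamp (ξ s) k = 0 := by
          have : ξ s k ≤ 0 := by linarith
          simp [clamp, this]
        linarith [drift_nonneg_of_eq_zero hlam (clamp_nonneg (ξ s)) (clamp_le_one (ξ s)) hcl]
    have hpos : 0 < 1 + t := by linarith [ht.1]
    have := key (-ξ t k / (2 * (1 + t))) (div_pos (by linarith) (by linarith))
    rw [div_mul_eq_mul_div, mul_div_mul_right _ _ hpos.ne'] at this
    linarith
  -- Mass conservation holds for the field at any vector, in particular at the clamped one. With
  -- non-negativity it confines the path to the cube, where the clamp is the identity.
  have hsum : ∀ t ∈ Icc 0 t₀, ∑ k, ξ t k = 1 := by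
    intro t ht
    have hd : ∀ s ∈ Icc 0 t₀, HasDerivWithinAt (fun t => ∑ k, ξ t k) 0 (Icc 0 t₀) s := by
      intro s hs
      have := HasDerivWithinAt.fun_sum (u := Finset.univ) fun k _ => hk k s hs
      rwa [sum_drift] at this
    have hc := constant_of_has_deriv_right_zero (f := fun t => ∑ k, ξ t k)
      (fun s hs => (hd s hs).continuousWithinAt)
      (fun s hs => hasDerivWithinAt_Ici_of_Icc (hd s (Ico_subset_Icc_self hs)) hs) t ht
    rw [hc, h0, hξ₀.2]
  have hle : ∀ t ∈ Icc 0 t₀, ∀ k, ξ t k ≤ 1 := fun t ht k =>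
    (hsum t ht) ▸ Finset.single_le_sum (fun j _ => hnn t ht j) (Finset.mem_univ k)
  refine ⟨ξ, ⟨h0, fun t ht => ?_⟩, fun t ht => ⟨hnn t ht, hsum t ht⟩⟩
  have := hξ t ht
  rwa [clamp_eq_self (hnn t ht) (hle t ht)] at this

lemma IsSolution.continuousOn {t₀ : ℝ} {ξ₀ : Fin (C + 1) → ℝ} {ξ : ℝ → Fin (C + 1) → ℝ}
    (h : IsSolution C lam t₀ ξ₀ ξ) : ContinuousOn ξ (Icc 0 t₀) :=
  fun t ht => (h.2 t ht).continuousWithinAt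

/-- Solutions need not lie in the simplex, but two of them stay in a common ball on the compact
interval, and there the field is Lipschitz. -/
lemma IsSolution.eqOn {t₀ : ℝ} {ξ₀ : Fin (C + 1) → ℝ} {ξ η : ℝ → Fin (C + 1) → ℝ}
    (hη : IsSolution C lam t₀ ξ₀ η) (hξ : IsSolution C lam t₀ ξ₀ ξ) : EqOn η ξ (Icc 0 t₀) := by
  obtain ⟨R₁, h1⟩ := isCompact_Icc.exists_bound_of_continuousOn hη.continuousOn
  obtain ⟨R₂, h2⟩ := isCompact_Icc.exists_bound_of_continuousOn hξ.continuousOn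
  obtain ⟨K, hK⟩ := (contDiff_drift (C := C) (lam := lam)).contDiffOn.exists_lipschitzOnWith
    one_ne_zero (convex_closedBall 0 (max R₁ R₂)) (isCompact_closedBall _ _)
  refine ODE_solution_unique_of_mem_Icc_right (v := fun _ => drift C lam)
    (s := fun _ => Metric.closedBall 0 (max R₁ R₂)) (fun _ _ => hK) hη.continuousOn
    (fun t ht => hasDerivWithinAt_Ici_of_Icc (hη.2 t (Ico_subset_Icc_self ht)) ht) (fun t ht => ?_) hξ.continuousOn
    (fun t ht => hasDerivWithinAt_Ici_of_Icc (hξ.2 t (Ico_subset_Icc_self ht)) ht) (fun t ht => ?_)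
    (hη.1.trans hξ.1.symm)
  · simpa using Or.inl (h1 t (Ico_subset_Icc_self ht))
  · simpa using Or.inr (h2 t (Ico_subset_Icc_self ht))

lemma isProfile_profile {ξ : Fin (C + 1) → ℝ} (h : ξ ∈ stdSimplex ℝ (Fin (C + 1))) :
    IsProfile C (profile ξ) where
  nonneg k := by
    unfold profile; split_ifs
    · exact h.1 _
    · exact le_rfl
  le_one k := by
    unfold profile; split_ifs
    · exact h.2 ▸ Finset.single_le_sum (fun j _ => h.1 j) (Finset.mem_univ _)
    · exact zero_le_one
  eq_zero k hk := by
    unfold profile; rw [dif_neg (by omega)]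

/-- Euler steps approximate a continuously differentiable function. -/
lemma exists_abs_sub_sub_sum_le {T : ℝ} {ψ ψ' : ℝ → ℝ}
    (hψ : ∀ t ∈ Icc 0 T, HasDerivWithinAt ψ (ψ' t) (Icc 0 T) t) (hψ' : ContinuousOn ψ' (Icc 0 T))
    {ε : ℝ} (hε : 0 < ε) :
    ∃ δ > 0, ∀ h : ℝ, 0 < h → h < δ → ∀ i : ℕ, i * h ≤ T →
      |ψ (i * h) - ψ 0 - ∑ l ∈ Finset.range i, h * ψ' (l * h)| ≤ i * h * ε := by
  obtain ⟨δ, hδ, hu⟩ := Metric.uniformContinuousOn_iff.1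
    (isCompact_Icc.uniformContinuousOn_of_continuous hψ') ε hε
  refine ⟨δ, hδ, fun h h0 hhδ i => ?_⟩
  induction i with
  | zero => simp
  | succ i ih =>
    intro hi
    have hi' : (i : ℝ) * h + h ≤ T := by
      rw [← add_one_mul]; exact_mod_cast hi
    have hih : 0 ≤ (i : ℝ) * h := by positivity
    have hstep : |ψ (i * h + h) - ψ (i * h) - h * ψ' (i * h)| ≤ h * ε := by
      have hsub : Icc ((i : ℝ) * h) (i * h + h) ⊆ Icc 0 T := Icc_subset_Icc hih hi'
      -- Subtracting the tangent slope at the left end leaves a function whose derivative is at most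
      -- `ε` by uniform continuity of `ψ'`; the mean value inequality bounds its increment.
      have hd : ∀ s ∈ Icc ((i : ℝ) * h) (i * h + h), HasDerivWithinAt
          (fun s => ψ s - s * ψ' (i * h)) (ψ' s - ψ' (i * h)) (Icc (i * h) (i * h + h)) s := by
        intro s hs
        have := ((hψ s (hsub hs)).mono hsub).sub
          ((hasDerivAt_id s).mul_const (ψ' (i * h))).hasDerivWithinAt
        rw [one_mul] at this
        exact this
      have hb : ∀ s ∈ Icc ((i : ℝ) * h) (i * h + h), ‖ψ' s - ψ' (i * h)‖ ≤ ε := by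
        intro s hs
        have := hu s (hsub hs) (i * h) (hsub ⟨le_rfl, by linarith⟩) (by
          rw [Real.dist_eq, abs_of_nonneg (by linarith [hs.1])]
          linarith [hs.2])
        rw [Real.dist_eq] at this
        exact this.le
      have := (convex_Icc _ _).norm_image_sub_le_of_norm_hasDerivWithin_le hd hb
        (left_mem_Icc.2 (by linarith)) (right_mem_Icc.2 (by linarith : (i : ℝ) * h ≤ i * h + h))
      rw [Real.norm_eq_abs, Real.norm_eq_abs, add_sub_cancel_left, abs_of_pos h0] at this
      rw [mul_comm h ε]
      convert this using 2
      ring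
    have e : ((i + 1 : ℕ) : ℝ) * h = i * h + h := by push_cast; ring
    rw [Finset.sum_range_succ, e]
    have h1 := ih (by linarith)
    rw [show ψ (i * h + h) - ψ 0 - (∑ l ∈ Finset.range i, h * ψ' (l * h) + h * ψ' (i * h)) =
      (ψ (i * h) - ψ 0 - ∑ l ∈ Finset.range i, h * ψ' (l * h)) +
        (ψ (i * h + h) - ψ (i * h) - h * ψ' (i * h)) by ring]
    refine (abs_add_le _ _).trans ?_
    linarith

end Solution

/-! ### Discrete Gronwall argument and the initial deviation -/

section Gronwall

open scoped Classical

variable {n C : ℕ} {lam : ℝ}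

lemma abs_sub_le_of_sum_bounds {F m G D E : ℕ → ℝ} {h a b p q : ℝ} {i : ℕ} (h0 : 0 ≤ h)
    (hF : |F i - F 0 - ∑ l ∈ Finset.range i, h * G l| ≤ a)
    (hm : |m i - m 0 - ∑ l ∈ Finset.range i, h * D l| ≤ 1) (hb : |F 0 - m 0| ≤ b)
    (hGD : ∀ l < i, |G l - D l| ≤ p * E l + q) :
    |F i - m i| ≤ a + 1 + b + p * ∑ l ∈ Finset.range i, h * E l + i * h * q := by
  have hs : |∑ l ∈ Finset.range i, h * G l - ∑ l ∈ Finset.range i, h * D l| ≤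
      p * ∑ l ∈ Finset.range i, h * E l + i * h * q := by
    rw [← Finset.sum_sub_distrib]
    refine (Finset.abs_sum_le_sum_abs _ _).trans ?_
    calc _ ≤ ∑ l ∈ Finset.range i, (p * (h * E l) + h * q) := by
          refine Finset.sum_le_sum fun l hl => ?_
          rw [← mul_sub, abs_mul, abs_of_nonneg h0]
          have := mul_le_mul_of_nonneg_left (hGD l (Finset.mem_range.1 hl)) h0
          linarith
      _ = _ := by
          rw [Finset.sum_add_distrib, ← Finset.mul_sum]
          simp [mul_assoc]
  have h1 := abs_le.1 hF
  have h2 := abs_le.1 hm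
  have h3 := abs_le.1 hb
  have h4 := abs_le.1 hs
  rw [abs_le]
  constructor <;> linarith

/-- The envelope `K * (1 + h * L) ^ i` solves the discrete Gronwall recursion with equality, so it
reproduces itself in the induction. -/
lemma sum_mul_geom (h L K : ℝ) (i : ℕ) :
    L * ∑ l ∈ Finset.range i, h * (K * (1 + h * L) ^ l) = K * (1 + h * L) ^ i - K := by
  have := mul_geom_sum (1 + h * L) i
  rw [Finset.mul_sum]
  calc _ = K * ((1 + h * L - 1) * ∑ l ∈ Finset.range i, (1 + h * L) ^ l) := by
        rw [Finset.mul_sum, Finset.mul_sum]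
        exact Finset.sum_congr rfl fun l _ => by ring
    _ = _ := by rw [this]; ring

/-- The growth rate of the deviation from the limiting equation. -/
def growth (lam : ℝ) (C : ℕ) : ℝ := 16 * lam + 4 * C + 3

/-- Discrete Gronwall argument: a path with small martingale parts stays close to the solution. -/
lemma closeTo_of_martingale_bounds (hlam : 0 ≤ lam) (hn : 2 < n) {h a E₀ T : ℝ} (h0 : 0 ≤ h)
    (ha : 0 ≤ a) {N : ℕ} (hT : N * h ≤ T) {x : ℕ → State n C} {ζ : ℕ → ℕ → ℝ}
    (hζ : ∀ i ≤ N, IsProfile C (ζ i))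
    (hstar : ∀ v, ∀ k ≤ C, ∀ i ≤ N, |starCount v k (x i).1 - starCount v k (x 0).1 -
      ∑ l ∈ Finset.range i, h * genAct lam C (starCount v k) (x l).1| ≤ a)
    (hpair : ∀ u v, u ≠ v → ∀ j ≤ C, ∀ k ≤ C, ∀ i ≤ N,
      |pairCount u v j k (x i).1 - pairCount u v j k (x 0).1 -
        ∑ l ∈ Finset.range i, h * genAct lam C (pairCount u v j k) (x l).1| ≤ a)
    (hind : ∀ u v, u ≠ v → ∀ i ≤ N, indirectCount u v (x i).1 - indirectCount u v (x 0).1 -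
      ∑ l ∈ Finset.range i, h * genAct lam C (indirectCount u v) (x l).1 ≤ a)
    (hode1 : ∀ k ≤ C, ∀ i ≤ N, |((n : ℝ) - 1) * ζ i k - ((n : ℝ) - 1) * ζ 0 k -
      ∑ l ∈ Finset.range i, h * (((n : ℝ) - 1) * linDrift lam C (share C (ζ l)) (ζ l) k)| ≤ 1)
    (hode2 : ∀ j ≤ C, ∀ k ≤ C, ∀ i ≤ N,
      |((n : ℝ) - 2) * (ζ i j * ζ i k) - ((n : ℝ) - 2) * (ζ 0 j * ζ 0 k) -
        ∑ l ∈ Finset.range i, h * (((n : ℝ) - 2) *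
          (linDrift lam C (share C (ζ l)) (ζ l) j * ζ l k +
            ζ l j * linDrift lam C (share C (ζ l)) (ζ l) k))| ≤ 1)
    (hE₀ : CloseTo C (ζ 0) E₀ (x 0).1) :
    ∀ i ≤ N, CloseTo C (ζ i)
      ((a + 1 + E₀ + 4 * lam * T) * (1 + h * growth lam C) ^ i) (x i).1 := by
  set L := growth lam C with hL
  set K := a + 1 + E₀ + 4 * lam * T with hK
  intro i
  induction i using Nat.strong_induction_on with
  | _ i ih =>
    intro hi
    have hT0 : (i : ℝ) * h ≤ T :=
      (mul_le_mul_of_nonneg_right (by exact_mod_cast hi) h0).trans hT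
    have hi0 : 0 ≤ (i : ℝ) * h := by positivity
    have hqT : (i : ℝ) * h * (4 * lam) ≤ 4 * lam * T := by
      rw [mul_comm]; exact mul_le_mul_of_nonneg_left hT0 (by positivity)
    have hEnn : 0 ≤ E₀ := (abs_nonneg _).trans (hE₀.star ⟨0, by omega⟩ 0 (Nat.zero_le _))
    have hT' : 0 ≤ T := hi0.trans hT0
    have hKnn : 0 ≤ K := by positivity
    have hLnn : 0 ≤ L := by rw [hL, growth]; positivity
    set Z := ∑ l ∈ Finset.range i, h * (K * (1 + h * L) ^ l) with hZ
    have hZnn : 0 ≤ Z := Finset.sum_nonneg fun l _ => by positivity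
    have hgeom : (16 * lam + 4 * C + 3) * Z = K * (1 + h * L) ^ i - K := sum_mul_geom h L K i
    have hlC : 0 ≤ lam * Z := by positivity
    have hlC' : 0 ≤ C * Z := by positivity
    have hlT : 0 ≤ lam * T := by positivity
    -- All three bounds close with one envelope: `growth` is at least `16 * lam + 2 * C + 1` (star
    -- counts), and twice it is at least `28 * lam + 8 * C + 6` (pair counts, which are allowed
    -- `2E`). The constant terms of the drift errors, over a time at most `T`, are covered by `4 *
    -- lam * T` in `K`.
    refine ⟨fun v k hk => ?_, fun u v huv j hj k hk => ?_, fun u v huv => ?_⟩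
    · have := abs_sub_le_of_sum_bounds (F := fun l => starCount v k (x l).1)
        (m := fun l => ((n : ℝ) - 1) * ζ l k) h0 (hstar v k hk i hi) (hode1 k hk i hi)
        (hE₀.star v k hk) (E := fun l => K * (1 + h * L) ^ l) fun l hl =>
          (ih l hl (by omega)).abs_genAct_starCount_sub_le hlam hn (hζ l (by omega)) v hk
      refine this.trans ?_
      rw [← hZ]
      linarith
    · have := abs_sub_le_of_sum_bounds (F := fun l => pairCount u v j k (x l).1)
        (m := fun l => ((n : ℝ) - 2) * (ζ l j * ζ l k)) h0 (hpair u v huv j hj k hk i hi)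
        (hode2 j hj k hk i hi) (hE₀.pair u v huv j hj k hk) (E := fun l => K * (1 + h * L) ^ l)
        fun l hl => (ih l hl (by omega)).abs_genAct_pairCount_sub_le hlam hn (hζ l (by omega))
          huv hj hk
      refine this.trans ?_
      rw [← hZ]
      linarith
    · have h1 := hind u v huv i hi
      have h2 := hE₀.indirect_le u v huv
      have h3 : ∑ l ∈ Finset.range i, h * genAct lam C (indirectCount u v) (x l).1 ≤
          i * h * lam := by
        refine (Finset.sum_le_card_nsmul _ _ (h * lam) fun l _ =>
          mul_le_mul_of_nonneg_left (genAct_indirectCount_le hlam hn _ huv) h0).trans_eq ?_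
        rw [Finset.card_range, nsmul_eq_mul, mul_assoc]
      have h4 : (i : ℝ) * h * lam ≤ lam * T := by
        rw [mul_comm]; exact mul_le_mul_of_nonneg_left hT0 hlam
      linarith

lemma starCount_eq_numLinks (x : Route n → ℕ) (v : Fin n) (k : ℕ) :
    starCount v k x = numLinks x v k := by
  rw [starCount, numLinks]
  simp only [level]
  rw [Finset.sum_boole, Finset.filter_filter]

lemma ind_eq_level (x : Route n → ℕ) {u w : Fin n} (h : u ≠ w) (k : ℕ) :
    ind x u w k = level x s(u, w) k := by
  simp [ind, level, h]

lemma phi3_nonneg (hn : 2 < n) (x : Route n → ℕ) : 0 ≤ phi3 x := by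
  have : (2 : ℝ) < n := by exact_mod_cast hn
  refine Real.iSup_nonneg fun q => mul_nonneg ?_ (Nat.cast_nonneg _)
  rw [one_div_nonneg]; linarith

lemma phi_nonneg (hn : 2 < n) (x : Route n → ℕ) : 0 ≤ phi C x :=
  (phi3_nonneg hn x).trans ((le_max_right _ _).trans (le_max_right _ _))

lemma indirectCount_le_mul_phi (hn : 2 < n) (x : Route n → ℕ) {u v : Fin n} (huv : u ≠ v) :
    indirectCount u v x ≤ n * phi C x := by
  have h2 : (2 : ℝ) < n := by exact_mod_cast hn
  have h3 : 1 / ((n : ℝ) - 2) * indirectCount u v x ≤ phi3 x := by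
    refine le_trans (le_of_eq ?_) (le_ciSup (Set.finite_range _).bddAbove
      (⟨(u, v), huv⟩ : Pairs n))
    rw [indirectCount, indirect, Nat.cast_sum]
  have h4 : phi3 x ≤ phi C x := (le_max_right _ _).trans (le_max_right _ _)
  rw [one_div, inv_mul_le_iff₀ (by linarith)] at h3
  nlinarith [phi_nonneg (C := C) hn x]

lemma sum_level_others_eq_sum_ind (x : Route n → ℕ) (u v : Fin n) (k : ℕ) :
    ∑ w with w ≠ u ∧ w ≠ v, ind x u w k = ∑ w with w ≠ u ∧ w ≠ v, level x s(u, w) k :=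
  Finset.sum_congr rfl fun _ hw => ind_eq_level x (Finset.mem_filter.1 hw).2.1.symm k

lemma abs_pairCount_sub_le_mul_phi (hn : 2 < n) (x : Route n → ℕ) {u v : Fin n} (huv : u ≠ v)
    {j k : ℕ} (hj : j ≤ C) (hk : k ≤ C) :
    |pairCount u v j k x - 1 / ((n : ℝ) - 2) * ((∑ w with w ≠ u ∧ w ≠ v, level x s(u, w) j) *
      ∑ w with w ≠ v ∧ w ≠ u, level x s(v, w) k)| ≤ n * phi C x := by
  have h2 : (2 : ℝ) < n := by exact_mod_cast hn
  have hsw : (Finset.univ.filter fun w : Fin n => w ≠ u ∧ w ≠ v) =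
      Finset.univ.filter fun w : Fin n => w ≠ v ∧ w ≠ u := by
    ext; simp [and_comm]
  have h3 := le_ciSup (Set.finite_range (fun q : Pairs n × Fin (C + 1) × Fin (C + 1) =>
    |1 / ((n : ℝ) - 2) * ∑ w, ind x q.1.1.1 w q.2.1 * ind x q.1.1.2 w q.2.2 -
      1 / ((n : ℝ) - 2) ^ 2 * ((∑ w with w ≠ q.1.1.1 ∧ w ≠ q.1.1.2, ind x q.1.1.1 w q.2.1) *
        ∑ w with w ≠ q.1.1.1 ∧ w ≠ q.1.1.2, ind x q.1.1.2 w q.2.2)|)).bddAbove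
    (⟨⟨(u, v), huv⟩, ⟨j, by omega⟩, ⟨k, by omega⟩⟩ : Pairs n × Fin (C + 1) × Fin (C + 1))
  have h4 : phi1 C x ≤ phi C x := le_max_left _ _
  -- The terms `w = u` and `w = v` of the full sum vanish because `ind` is zero on the diagonal.
  have h5 : ∑ w, ind x u w j * ind x v w k = pairCount u v j k x := by
    rw [pairCount, Finset.sum_filter]
    refine Finset.sum_congr rfl fun w _ => ?_
    split_ifs with h
    · rw [ind_eq_level x h.1.symm, ind_eq_level x h.2.symm]
    · by_cases hu : w = u
      · simp [ind, hu]
      · have hv : w = v := by tauto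
        simp [ind, hv]
  have h6 := (h3.trans (le_of_eq rfl : _ ≤ phi1 C x)).trans h4
  simp only at h6
  rw [h5, sum_level_others_eq_sum_ind, hsw, sum_level_others_eq_sum_ind, ← hsw] at h6
  have e : pairCount u v j k x - 1 / ((n : ℝ) - 2) *
      ((∑ w with w ≠ u ∧ w ≠ v, level x s(u, w) j) * ∑ w with w ≠ v ∧ w ≠ u, level x s(v, w) k) =
      ((n : ℝ) - 2) * (1 / ((n : ℝ) - 2) * pairCount u v j k x - 1 / ((n : ℝ) - 2) ^ 2 *
        ((∑ w with w ≠ u ∧ w ≠ v, level x s(u, w) j) *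
          ∑ w with w ≠ v ∧ w ≠ u, level x s(v, w) k)) := by
    field_simp [show (n : ℝ) - 2 ≠ 0 by linarith]
  rw [e, abs_mul, abs_of_pos (by linarith)]
  rw [hsw] at h6 ⊢
  have := phi_nonneg (C := C) hn x
  refine (mul_le_mul_of_nonneg_left h6 (by linarith)).trans ?_
  nlinarith

/-- The initial deviation from the limit, in terms of the initial values of `f` and `phi`. -/
lemma closeTo_initial (hn : 2 < n) (x : Route n → ℕ) {ζ : ℕ → ℝ} (hζ : IsProfile C ζ) {A : ℝ}
    (hA : ∀ v, ∀ k ≤ C, |starCount v k x - ((n : ℝ) - 1) * ζ k| ≤ A) :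
    CloseTo C ζ (A + n * phi C x + 1) x := by
  have h2 : (2 : ℝ) < n := by exact_mod_cast hn
  have hφ : 0 ≤ n * phi C x := mul_nonneg (Nat.cast_nonneg _) (phi_nonneg hn x)
  have hA0 : 0 ≤ A := (abs_nonneg _).trans (hA ⟨0, by omega⟩ 0 (Nat.zero_le _))
  refine ⟨fun v k hk => (hA v k hk).trans (by linarith), fun u v huv j hj k hk => ?_,
    fun u v huv => (indirectCount_le_mul_phi (C := C) hn x huv).trans (by linarith)⟩
  have hs : ∀ u v : Fin n, u ≠ v → ∀ j ≤ C,
      |∑ w with w ≠ u ∧ w ≠ v, level x s(u, w) j - ((n : ℝ) - 2) * ζ j| ≤ A + 1 ∧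
      0 ≤ ∑ w with w ≠ u ∧ w ≠ v, level x s(u, w) j ∧
      ∑ w with w ≠ u ∧ w ≠ v, level x s(u, w) j ≤ (n : ℝ) - 2 := by
    intro u v huv j hj
    refine ⟨?_, Finset.sum_nonneg fun _ _ => level_nonneg _ _ _, ?_⟩
    · rw [sum_level_others x huv.symm]
      have h1 := abs_le.1 (hA u j hj)
      have := hζ.nonneg j
      have := hζ.le_one j
      have := level_nonneg x s(u, v) j
      have := level_le_one x s(u, v) j
      rw [abs_le]
      constructor <;> linarith
    · refine (Finset.sum_le_card_nsmul _ _ 1 fun w _ => level_le_one _ _ _).trans ?_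
      rw [card_others huv, nsmul_eq_mul, mul_one, Nat.cast_sub hn.le]
      simp
  obtain ⟨a1, a2, a3⟩ := hs u v huv j hj
  obtain ⟨b1, b2, b3⟩ := hs v u huv.symm k hk
  have hp := abs_pairCount_sub_le_mul_phi hn x huv hj hk
  set p := ∑ w with w ≠ u ∧ w ≠ v, level x s(u, w) j
  set q := ∑ w with w ≠ v ∧ w ≠ u, level x s(v, w) k
  -- The product is changed one factor at a time: each factor is off by at most `A + 1`, the 1 being
  -- the omitted link `{u, v}`, and is multiplied by a number in `[0, 1]`.
  have e : 1 / ((n : ℝ) - 2) * (p * q) - ((n : ℝ) - 2) * (ζ j * ζ k) =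
      (p - ((n : ℝ) - 2) * ζ j) * (q / ((n : ℝ) - 2)) + ζ j * (q - ((n : ℝ) - 2) * ζ k) := by
    field_simp [show (n : ℝ) - 2 ≠ 0 by linarith]
    ring
  have hq1 : |q / ((n : ℝ) - 2)| ≤ 1 := by
    rw [abs_of_nonneg (div_nonneg b2 (by linarith)), div_le_one (by linarith)]
    exact b3
  have hz1 : |ζ j| ≤ 1 := by
    rw [abs_of_nonneg (hζ.nonneg j)]; exact hζ.le_one j
  have hpq : |1 / ((n : ℝ) - 2) * (p * q) - ((n : ℝ) - 2) * (ζ j * ζ k)| ≤ (A + 1) + (A + 1) := by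
    rw [e]
    refine (abs_add_le _ _).trans (add_le_add ?_ ?_)
    · rw [abs_mul]
      exact (mul_le_of_le_one_right (abs_nonneg _) hq1).trans a1
    · rw [abs_mul]
      exact (mul_le_of_le_one_left (abs_nonneg _) hz1).trans b1
  have := (abs_sub_le _ _ _).trans (add_le_add hp hpq)
  linarith

end Gronwall

/-! ### Simultaneous control of the martingale parts -/

section Observables

variable {n C : ℕ} {lam : ℝ}

/-- Indices for the functions of the load vector whose fluctuations are controlled; the Boolean is
a sign. -/
abbrev ObsIndex (n C : ℕ) : Type :=
  Bool × ((Fin n × Fin (C + 1)) ⊕ (Fin n × Fin n × Fin (C + 1) × Fin (C + 1)) ⊕ (Fin n × Fin n))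

/-- The functions of the load vector whose fluctuations are controlled, without sign. -/
noncomputable def unsignedObs :
    (Fin n × Fin (C + 1)) ⊕ (Fin n × Fin n × Fin (C + 1) × Fin (C + 1)) ⊕ (Fin n × Fin n) →
      (Route n → ℕ) → ℝ
  | Sum.inl (v, k) => starCount v k
  | Sum.inr (Sum.inl (u, v, j, k)) => pairCount u v j k
  | Sum.inr (Sum.inr (u, v)) => indirectCount u v

/-- The functions of the load vector whose fluctuations are controlled. -/
noncomputable def obs : ObsIndex n C → (Route n → ℕ) → ℝ
  | (true, o) => unsignedObs o
  | (false, o) => fun x => -unsignedObs o x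

lemma exists_jumpBound_obs (o : ObsIndex n C) : ∃ u v, JumpBound u v (obs o) := by
  have h : ∀ o : (Fin n × Fin (C + 1)) ⊕ (Fin n × Fin n × Fin (C + 1) × Fin (C + 1)) ⊕
      (Fin n × Fin n), ∃ u v, JumpBound u v (unsignedObs o) := by
    rintro (⟨v, k⟩ | ⟨u, v, j, k⟩ | ⟨u, v⟩)
    · exact ⟨_, _, jumpBound_starCount v k⟩
    · exact ⟨_, _, jumpBound_pairCount u v j k⟩
    · exact ⟨_, _, jumpBound_indirectCount u v⟩
  obtain ⟨b, o⟩ := o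
  obtain ⟨u, v, h⟩ := h o
  cases b
  · exact ⟨u, v, h.neg⟩
  · exact ⟨u, v, h⟩

lemma card_obsIndex_le (n C : ℕ) (hn : 0 < n) :
    (Fintype.card (ObsIndex n C) : ℝ) ≤ 6 * (n : ℝ) ^ 2 * ((C : ℝ) + 1) ^ 2 := by
  simp only [ObsIndex, Fintype.card_prod, Fintype.card_sum, Fintype.card_bool, Fintype.card_fin]
  push_cast
  have h1 : (1 : ℝ) ≤ n := by exact_mod_cast hn
  have h2 : (1 : ℝ) ≤ (C : ℝ) + 1 := by linarith [Nat.cast_nonneg (α := ℝ) C]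
  set D : ℝ := (C : ℝ) + 1
  have a1 : (n : ℝ) * D ≤ (n : ℝ) ^ 2 * D ^ 2 := by
    have := mul_le_mul h1 h2 zero_le_one (by linarith)
    nlinarith [mul_nonneg (show (0 : ℝ) ≤ n by linarith) (show (0 : ℝ) ≤ D by linarith)]
  have a2 : (n : ℝ) * n ≤ (n : ℝ) ^ 2 * D ^ 2 := by
    have : (1 : ℝ) ≤ D ^ 2 := one_le_pow₀ h2
    nlinarith [mul_nonneg (show (0 : ℝ) ≤ n by linarith) (show (0 : ℝ) ≤ n by linarith)]
  nlinarith

lemma genAct_neg (g : (Route n → ℕ) → ℝ) (x : Route n → ℕ) :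
    genAct lam C (fun y => -g y) x = -genAct lam C g x := by
  simp only [genAct, ← Finset.sum_neg_distrib]
  exact Finset.sum_congr rfl fun r _ => by ring

/-- The times of the grid with mesh `t₀ / 2 ^ m`. -/
noncomputable def gridTime (t₀ : ℝ) (m i : ℕ) : ℝ≥0 := i * (t₀.toNNReal / 2 ^ m)

lemma coe_gridTime {t₀ : ℝ} (ht₀ : 0 ≤ t₀) (m i : ℕ) :
    (gridTime t₀ m i : ℝ) = i * (t₀ / 2 ^ m) := by
  simp [gridTime, ht₀]

lemma gridTime_zero (t₀ : ℝ) (m : ℕ) : gridTime t₀ m 0 = 0 := by simp [gridTime]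

lemma monotone_gridTime (t₀ : ℝ) (m : ℕ) : Monotone (gridTime t₀ m) := fun i j hij => by
  unfold gridTime
  gcongr

open scoped Classical in
/-- The probability that some observable has a large martingale part on a fine grid. -/
lemma eventually_measureReal_exceeds_le {Ω : Type*} [MeasurableSpace Ω] {P : Measure Ω}
    [IsProbabilityMeasure P] (hlam : 0 ≤ lam) (hn : 2 < n) {X : ℝ≥0 → Ω → State n C}
    (hX : IsRoutingProcess P n C lam X) {t₀ : ℝ} (ht₀ : 0 < t₀) {θ a ε : ℝ} (hθ : 0 ≤ θ)
    (hθ4 : 4 * θ ≤ 1) (hε : 0 < ε) :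
    ∀ᶠ m : ℕ in atTop, P.real {ω | ∃ o : ObsIndex n C,
      Exceeds (fun s : State n C => θ * obs o s.1)
        (fun s => t₀ / 2 ^ m * ∑ z, generator n C lam s z * (θ * obs o z.1 - θ * obs o s.1))
        (θ * a) (fun i : Fin (2 ^ m + 1) => X (gridTime t₀ m i) ω)} ≤
      Fintype.card (ObsIndex n C) *
        Real.exp (-(θ * a) + t₀ * (θ ^ 2 * (8 * n * (2 * lam + C)) + ε)) := by
  have hmesh : Tendsto (fun m : ℕ => t₀ / 2 ^ m) atTop (𝓝[>] 0) := by
    refine tendsto_nhdsWithin_iff.2 ⟨?_, Eventually.of_forall fun m =>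
      show (0 : ℝ) < t₀ / 2 ^ m by positivity⟩
    exact tendsto_const_nhds.div_atTop (tendsto_pow_atTop_atTop_of_one_lt one_lt_two)
  have hall : ∀ o : ObsIndex n C, ∀ᶠ m : ℕ in atTop, ∀ (N : ℕ) (b : ℝ) (x : State n C),
      ∑ z : Fin N → State n C, (if Exceeds (fun s : State n C => θ * obs o s.1)
          (fun s => t₀ / 2 ^ m * ∑ z, generator n C lam s z * (θ * obs o z.1 - θ * obs o s.1)) b
          (Fin.cons x z : Fin (N + 1) → State n C) then
        pathWeight (fun x y => NormedSpace.exp ((t₀ / 2 ^ m) • generator n C lam) x y)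
          (Fin.cons x z : Fin (N + 1) → State n C) else 0) ≤
      Real.exp (-b + N * (t₀ / 2 ^ m) * (θ ^ 2 * (8 * n * (2 * lam + C)) + ε)) := by
    intro o
    obtain ⟨u, v, hj⟩ := exists_jumpBound_obs o
    -- The observable is scaled by `θ`: jumps of size at most 4 become at most `4 * θ ≤ 1`, and the
    -- quadratic variation is multiplied by `θ ^ 2`.
    refine hmesh.eventually (eventually_sum_pathWeight_exceeds_le
      (Q := generator n C lam) (fun x y hxy => generator_nonneg hlam hn hxy) sum_generator hε
      (by positivity) (fun x y hxy hq => ?_) fun x => ?_)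
    · rw [← mul_sub, abs_mul, abs_of_nonneg hθ]
      nlinarith [hj.abs_sub_le hxy hq]
    · simp only [← mul_sub, mul_pow, mul_left_comm _ (θ ^ 2), ← Finset.mul_sum]
      exact mul_le_mul_of_nonneg_left (hj.sum_generator_mul_sq_le hlam hn x) (sq_nonneg _)
  filter_upwards [eventually_all.2 hall] with m hm
  have hN : ((2 ^ m : ℕ) : ℝ) * (t₀ / 2 ^ m) = t₀ := by
    push_cast
    field_simp
  have hsub : ∀ o : ObsIndex n C, P.real {ω | Exceeds (fun s : State n C => θ * obs o s.1)
        (fun s => t₀ / 2 ^ m * ∑ z, generator n C lam s z * (θ * obs o z.1 - θ * obs o s.1))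
        (θ * a) (fun i : Fin (2 ^ m + 1) => X (gridTime t₀ m i) ω)} ≤
      Real.exp (-(θ * a) + t₀ * (θ ^ 2 * (8 * n * (2 * lam + C)) + ε)) := by
    intro o
    refine measureReal_path_le (Y := fun ω (i : Fin (2 ^ m + 1)) => X (gridTime t₀ m i) ω)
      (p := fun x y => NormedSpace.exp ((t₀ / 2 ^ m) • generator n C lam) x y)
      (fun x => hX.measurable _ _) (fun y => ?_) fun x => ?_
    · have h1 := hX.markov (2 ^ m) (fun i => gridTime t₀ m i)
        (fun i j hij => monotone_gridTime t₀ m (by exact_mod_cast hij)) y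
      have h2 : ∀ i : Fin (2 ^ m), (gridTime t₀ m (i.succ : Fin (2 ^ m + 1)) : ℝ) -
          gridTime t₀ m (i.castSucc : Fin (2 ^ m + 1)) = t₀ / 2 ^ m := by
        intro i
        rw [coe_gridTime ht₀.le, coe_gridTime ht₀.le]
        simp
        ring
      simp only [h2] at h1
      simpa [pathWeight, funext_iff] using h1
    · refine (hm o (2 ^ m) (θ * a) x).trans_eq ?_
      rw [hN]
  calc _ = P.real (⋃ o : ObsIndex n C, {ω | Exceeds (fun s : State n C => θ * obs o s.1)
        (fun s => t₀ / 2 ^ m * ∑ z, generator n C lam s z * (θ * obs o z.1 - θ * obs o s.1))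
        (θ * a) (fun i : Fin (2 ^ m + 1) => X (gridTime t₀ m i) ω)}) := by
        congr 1
        ext ω
        simp
    _ ≤ ∑ o : ObsIndex n C, _ := measureReal_iUnion_fintype_le _
    _ ≤ _ := (Finset.sum_le_card_nsmul _ _ _ fun o _ => hsub o).trans_eq (by
        rw [nsmul_eq_mul, Finset.card_univ])

lemma sum_ite_lt_eq_sum_range {N : ℕ} (f : ℕ → ℝ) (i : Fin (N + 1)) :
    ∑ l : Fin (N + 1), (if l < i then f l else 0) = ∑ l ∈ Finset.range i, f l := by
  have h1 := Fin.sum_univ_eq_sum_range (fun l => if l < (i : ℕ) then f l else 0) (N + 1)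
  simp only [Fin.val_fin_lt] at h1
  rw [h1, ← Finset.sum_filter]
  congr 1
  ext l
  simp only [Finset.mem_filter, Finset.mem_range]
  omega

lemma obs_lt_of_not_exceeds {θ a h : ℝ} (hθ : 0 < θ) {N : ℕ} {x : ℕ → State n C}
    {o : ObsIndex n C}
    (hx : ¬ Exceeds (fun s : State n C => θ * obs o s.1)
        (fun s => h * ∑ z, generator n C lam s z * (θ * obs o z.1 - θ * obs o s.1))
        (θ * a) (fun i : Fin (N + 1) => x i)) {i : ℕ} (hi : i ≤ N) :
    obs o (x i).1 - obs o (x 0).1 - ∑ l ∈ Finset.range i, h * genAct lam C (obs o) (x l).1 < a := by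
  unfold Exceeds at hx
  push Not at hx
  have h1 := hx ⟨i, by omega⟩
  rw [sum_ite_lt_eq_sum_range (fun l => h * ∑ z, generator n C lam (x l) z *
    (θ * obs o z.1 - θ * obs o (x l).1))] at h1
  simp only [← mul_sub, mul_left_comm _ θ, ← Finset.mul_sum, sum_generator_mul_sub,
    Fin.val_zero] at h1
  have h2 := lt_of_mul_lt_mul_left h1 hθ.le
  rw [Finset.mul_sum] at h2
  exact h2

/-- The maximal inequality is one-sided; having both signs among the indices makes the bound
two-sided. -/
lemma abs_unsignedObs_le {θ a h : ℝ} (hθ : 0 < θ) {N : ℕ} {x : ℕ → State n C}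
    (hx : ¬ ∃ o : ObsIndex n C, Exceeds (fun s : State n C => θ * obs o s.1)
        (fun s => h * ∑ z, generator n C lam s z * (θ * obs o z.1 - θ * obs o s.1))
        (θ * a) (fun i : Fin (N + 1) => x i)) {i : ℕ} (hi : i ≤ N)
    (o : (Fin n × Fin (C + 1)) ⊕ (Fin n × Fin n × Fin (C + 1) × Fin (C + 1)) ⊕ (Fin n × Fin n)) :
    |unsignedObs o (x i).1 - unsignedObs o (x 0).1 -
      ∑ l ∈ Finset.range i, h * genAct lam C (unsignedObs o) (x l).1| ≤ a := by
  push Not at hx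
  have h1 := obs_lt_of_not_exceeds hθ (hx (true, o)) hi
  have h2 := obs_lt_of_not_exceeds hθ (hx (false, o)) hi
  simp only [obs, genAct_neg, mul_neg, Finset.sum_neg_distrib] at h1 h2
  rw [abs_le]
  constructor <;> linarith

end Observables

/-! ### Deviation bound along a fine grid -/

section Grid

variable {n C : ℕ} {lam t₀ : ℝ}

lemma natCast_mul_mesh_le (ht₀ : 0 ≤ t₀) {m i : ℕ} (hi : i ≤ 2 ^ m) :
    (i : ℝ) * (t₀ / 2 ^ m) ≤ t₀ := by
  have h : (i : ℝ) ≤ 2 ^ m := by exact_mod_cast hi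
  rw [mul_div_assoc', div_le_iff₀ (by positivity), mul_comm]
  exact mul_le_mul_of_nonneg_left h ht₀

lemma tendsto_mesh (t₀ : ℝ) : Tendsto (fun m : ℕ => t₀ / 2 ^ m) atTop (𝓝 0) :=
  tendsto_const_nhds.div_atTop (tendsto_pow_atTop_atTop_of_one_lt one_lt_two)

/-- Slope errors below `1 / t₀` accumulate to at most 1 over `[0, t₀]`. -/
lemma eventually_abs_sub_sub_sum_le (ht₀ : 0 < t₀) {ψ ψ' : ℝ → ℝ}
    (hψ : ∀ t ∈ Icc 0 t₀, HasDerivWithinAt ψ (ψ' t) (Icc 0 t₀) t)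
    (hψ' : ContinuousOn ψ' (Icc 0 t₀)) :
    ∀ᶠ m : ℕ in atTop, ∀ i : ℕ, i ≤ 2 ^ m → |ψ (i * (t₀ / 2 ^ m)) - ψ 0 -
      ∑ l ∈ Finset.range i, t₀ / 2 ^ m * ψ' (l * (t₀ / 2 ^ m))| ≤ 1 := by
  obtain ⟨δ, hδ, h⟩ := exists_abs_sub_sub_sum_le hψ hψ' (one_div_pos.2 ht₀)
  filter_upwards [(tendsto_mesh t₀).eventually (gt_mem_nhds hδ)] with m hm i hi
  have hT := natCast_mul_mesh_le ht₀.le hi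
  refine (h _ (by positivity) hm i hT).trans ?_
  rw [mul_one_div, div_le_one ht₀]
  exact hT

lemma IsSolution.hasDerivWithinAt_profile {ξ₀ : Fin (C + 1) → ℝ} {ξ : ℝ → Fin (C + 1) → ℝ}
    (h : IsSolution C lam t₀ ξ₀ ξ) {k : ℕ} (hk : k ≤ C) {t : ℝ} (ht : t ∈ Icc 0 t₀) :
    HasDerivWithinAt (fun t => profile (ξ t) k)
      (linDrift lam C (share C (profile (ξ t))) (profile (ξ t)) k) (Icc 0 t₀) t := by
  have h1 := hasDerivWithinAt_pi.1 (h.2 t ht) ⟨k, Nat.lt_succ_of_le hk⟩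
  rw [drift_eq_linDrift] at h1
  have h2 : (fun t => profile (ξ t) k) = fun t => ξ t ⟨k, Nat.lt_succ_of_le hk⟩ := by
    funext t
    exact profile_coe (ξ t) ⟨k, Nat.lt_succ_of_le hk⟩
  rw [h2]
  exact h1

lemma IsSolution.continuousOn_profile {ξ₀ : Fin (C + 1) → ℝ} {ξ : ℝ → Fin (C + 1) → ℝ}
    (h : IsSolution C lam t₀ ξ₀ ξ) (k : ℕ) : ContinuousOn (fun t => profile (ξ t) k) (Icc 0 t₀) := by
  unfold profile
  split_ifs with hk
  · exact (continuous_apply _).comp_continuousOn h.continuousOn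
  · exact continuousOn_const

lemma IsSolution.continuousOn_linDrift {ξ₀ : Fin (C + 1) → ℝ} {ξ : ℝ → Fin (C + 1) → ℝ}
    (h : IsSolution C lam t₀ ξ₀ ξ) (k : ℕ) :
    ContinuousOn (fun t => linDrift lam C (share C (profile (ξ t))) (profile (ξ t)) k)
      (Icc 0 t₀) := by
  have := h.continuousOn_profile k
  have := h.continuousOn_profile (k - 1)
  have := h.continuousOn_profile (k + 1)
  have := h.continuousOn_profile C
  unfold linDrift share
  split_ifs <;> fun_prop

/-- On fine grids the Euler steps of the limiting equation are accurate. -/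
lemma IsSolution.eventually_euler (ht₀ : 0 < t₀) {ξ₀ : Fin (C + 1) → ℝ}
    {ξ : ℝ → Fin (C + 1) → ℝ} (h : IsSolution C lam t₀ ξ₀ ξ) (c₁ c₂ : ℝ) :
    ∀ᶠ m : ℕ in atTop, (∀ k ≤ C, ∀ i : ℕ, i ≤ 2 ^ m →
      |c₁ * profile (ξ (i * (t₀ / 2 ^ m))) k - c₁ * profile (ξ 0) k -
        ∑ l ∈ Finset.range i, t₀ / 2 ^ m * (c₁ *
          linDrift lam C (share C (profile (ξ (l * (t₀ / 2 ^ m)))))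
            (profile (ξ (l * (t₀ / 2 ^ m)))) k)| ≤ 1) ∧
      ∀ j ≤ C, ∀ k ≤ C, ∀ i : ℕ, i ≤ 2 ^ m →
        |c₂ * (profile (ξ (i * (t₀ / 2 ^ m))) j * profile (ξ (i * (t₀ / 2 ^ m))) k) -
          c₂ * (profile (ξ 0) j * profile (ξ 0) k) -
          ∑ l ∈ Finset.range i, t₀ / 2 ^ m * (c₂ *
            (linDrift lam C (share C (profile (ξ (l * (t₀ / 2 ^ m)))))
                (profile (ξ (l * (t₀ / 2 ^ m)))) j * profile (ξ (l * (t₀ / 2 ^ m))) k +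
              profile (ξ (l * (t₀ / 2 ^ m))) j *
                linDrift lam C (share C (profile (ξ (l * (t₀ / 2 ^ m)))))
                  (profile (ξ (l * (t₀ / 2 ^ m)))) k))| ≤ 1 := by
  refine Eventually.and ?_ ?_
  · refine (Set.finite_Iic C).eventually_all.2 fun k hk => ?_
    exact eventually_abs_sub_sub_sum_le ht₀
      (fun t ht => (h.hasDerivWithinAt_profile hk ht).const_mul c₁)
      ((h.continuousOn_linDrift k).const_smul c₁)
  · refine (Set.finite_Iic C).eventually_all.2 fun j hj =>
      (Set.finite_Iic C).eventually_all.2 fun k hk => ?_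
    have h1 := h.continuousOn_linDrift j
    have h2 := h.continuousOn_linDrift k
    have h3 := h.continuousOn_profile j
    have h4 := h.continuousOn_profile k
    exact eventually_abs_sub_sub_sum_le ht₀ (fun t ht => ((h.hasDerivWithinAt_profile hj ht).mul
      (h.hasDerivWithinAt_profile hk ht)).const_mul c₂) (by fun_prop)

/-- On a fine grid, the deviation bound holds unless some observable has a large martingale part. -/
lemma IsSolution.eventually_closeTo (hlam : 0 ≤ lam) (hn : 2 < n) (ht₀ : 0 < t₀)
    {ξ₀ : Fin (C + 1) → ℝ} {ξ : ℝ → Fin (C + 1) → ℝ} (h : IsSolution C lam t₀ ξ₀ ξ)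
    (hs : ∀ t ∈ Icc 0 t₀, ξ t ∈ stdSimplex ℝ (Fin (C + 1))) {θ a : ℝ} (hθ : 0 < θ) (ha : 0 ≤ a) :
    ∀ᶠ m : ℕ in atTop, ∀ x : ℕ → State n C,
      (¬ ∃ o : ObsIndex n C, Exceeds (fun s : State n C => θ * obs o s.1)
        (fun s => t₀ / 2 ^ m * ∑ z, generator n C lam s z * (θ * obs o z.1 - θ * obs o s.1))
        (θ * a) (fun i : Fin (2 ^ m + 1) => x i)) →
      ∀ A : ℝ, (∀ v, ∀ k ≤ C, |starCount v k (x 0).1 - ((n : ℝ) - 1) * profile ξ₀ k| ≤ A) →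
      ∀ i : ℕ, i ≤ 2 ^ m → CloseTo C (profile (ξ (i * (t₀ / 2 ^ m))))
        ((a + 2 + A + n * phi C (x 0).1 + 4 * lam * t₀) *
          Real.exp (growth lam C * t₀)) (x i).1 := by
  -- Only the deterministic Euler estimate decides how large `m` must be. The threshold is therefore
  -- uniform in the path `x`, which in the application depends on `m`.
  filter_upwards [h.eventually_euler ht₀ ((n : ℝ) - 1) ((n : ℝ) - 2)] with m hm x hx A hA i hi
  have hmesh : 0 ≤ t₀ / 2 ^ m := by positivity
  have hobs := fun (i : ℕ) (hi : i ≤ 2 ^ m) => abs_unsignedObs_le hθ hx hi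
  have hζ : ∀ i : ℕ, i ≤ 2 ^ m → IsProfile C (profile (ξ (i * (t₀ / 2 ^ m)))) := fun i hi =>
    isProfile_profile (hs _ ⟨by positivity, natCast_mul_mesh_le ht₀.le hi⟩)
  have hinit : CloseTo C (profile (ξ (((0 : ℕ) : ℝ) * (t₀ / 2 ^ m)))) (A + n * phi C (x 0).1 + 1)
      (x 0).1 := by
    refine closeTo_initial hn _ (hζ 0 (Nat.zero_le _)) ?_
    rw [Nat.cast_zero, zero_mul, h.1]
    exact hA
  have key := closeTo_of_martingale_bounds hlam hn hmesh ha (N := 2 ^ m) (T := t₀)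
    (natCast_mul_mesh_le ht₀.le le_rfl) (x := x) (ζ := fun i => profile (ξ (i * (t₀ / 2 ^ m)))) hζ
    (fun v k hk i hi => hobs i hi (Sum.inl (v, ⟨k, Nat.lt_succ_of_le hk⟩)))
    (fun u v _ j hj k hk i hi => hobs i hi
      (Sum.inr (Sum.inl (u, v, ⟨j, Nat.lt_succ_of_le hj⟩, ⟨k, Nat.lt_succ_of_le hk⟩))))
    (fun u v _ i hi => (le_abs_self _).trans (hobs i hi (Sum.inr (Sum.inr (u, v)))))
    (by simpa using hm.1) (by simpa using hm.2) hinit i hi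
  have hφ : 0 ≤ n * phi C (x 0).1 := mul_nonneg (Nat.cast_nonneg _) (phi_nonneg hn _)
  have hA0 : 0 ≤ A := (abs_nonneg _).trans (hA ⟨0, by omega⟩ 0 (Nat.zero_le _))
  have hg : 0 ≤ growth lam C := by unfold growth; positivity
  have hpow : (1 + t₀ / 2 ^ m * growth lam C) ^ i ≤ Real.exp (growth lam C * t₀) := by
    calc _ ≤ Real.exp (t₀ / 2 ^ m * growth lam C) ^ i := by
          refine pow_le_pow_left₀ (by positivity) ?_ _
          rw [add_comm]; exact Real.add_one_le_exp _
      _ = Real.exp (growth lam C * (i * (t₀ / 2 ^ m))) := by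
          rw [← Real.exp_nat_mul]; ring_nf
      _ ≤ _ := Real.exp_le_exp.2
          (mul_le_mul_of_nonneg_left (natCast_mul_mesh_le ht₀.le hi) hg)
  have hE : (a + 1 + (A + n * phi C (x 0).1 + 1) + 4 * lam * t₀) *
      (1 + t₀ / 2 ^ m * growth lam C) ^ i ≤
      (a + 2 + A + n * phi C (x 0).1 + 4 * lam * t₀) * Real.exp (growth lam C * t₀) := by
    rw [show a + 1 + (A + n * phi C (x 0).1 + 1) + 4 * lam * t₀ =
      a + 2 + A + n * phi C (x 0).1 + 4 * lam * t₀ by ring]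
    exact mul_le_mul_of_nonneg_left hpow (by positivity)
  exact ⟨fun v k hk => (key.star v k hk).trans hE,
    fun u v huv j hj k hk => (key.pair u v huv j hj k hk).trans (by linarith),
    fun u v huv => (key.indirect_le u v huv).trans (by linarith)⟩

end Grid

/-! ### Constants and the size of `n` -/

section Numerics

variable {n C : ℕ} {lam t₀ : ℝ}

lemma two_le_add_one_div {a : ℝ} (ha : 0 < a) : 2 ≤ a + 1 / a := by
  rw [← sub_nonneg]
  have : a + 1 / a - 2 = (a - 1) ^ 2 / a := by field_simp; ring
  rw [this]; positivity

/-- As `a + 1 / a ≥ 2`, the lower bound on `n` contains the factor `2 ^ 18 * 2 ^ 4 * 2 ^ 2`. -/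
lemma two_pow_mul_le (hlam : 0 < lam) (ht₀ : 0 < t₀)
    (hn : 2 ^ 18 * (lam + 1 / lam) ^ 4 * ((C : ℝ) + 1) ^ 6 * (t₀ + 1 / t₀) ^ 2 ≤ (n : ℝ)) :
    2 ^ 24 * ((C : ℝ) + 1) ^ 2 ≤ n := by
  refine le_trans ?_ hn
  have h1 : (2 : ℝ) ^ 4 ≤ (lam + 1 / lam) ^ 4 :=
    pow_le_pow_left₀ (by norm_num) (two_le_add_one_div hlam) 4
  have h2 : (2 : ℝ) ^ 2 ≤ (t₀ + 1 / t₀) ^ 2 :=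
    pow_le_pow_left₀ (by norm_num) (two_le_add_one_div ht₀) 2
  have h3 : ((C : ℝ) + 1) ^ 2 ≤ ((C : ℝ) + 1) ^ 6 :=
    pow_le_pow_right₀ (by linarith [Nat.cast_nonneg (α := ℝ) C]) (by norm_num)
  calc (2 : ℝ) ^ 24 * ((C : ℝ) + 1) ^ 2 = 2 ^ 18 * 2 ^ 4 * ((C : ℝ) + 1) ^ 2 * 2 ^ 2 := by ring
    _ ≤ _ := by gcongr

/-- The rate in the Gaussian tail of the martingale parts. -/
noncomputable def tailRate (lam : ℝ) (C : ℕ) (t₀ : ℝ) : ℝ := 1 / (1 + 16 * t₀ * (2 * lam + C))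

lemma tailRate_pos (hlam : 0 < lam) (ht₀ : 0 < t₀) : 0 < tailRate lam C t₀ := by
  unfold tailRate; positivity

lemma tailRate_le_one (hlam : 0 < lam) (ht₀ : 0 < t₀) : tailRate lam C t₀ ≤ 1 := by
  unfold tailRate
  rw [div_le_one (by positivity)]
  have : 0 ≤ 16 * t₀ * (2 * lam + C) := by positivity
  linarith

lemma gam_pos (hlam : 0 < lam) (ht₀ : 0 < t₀) : 0 < gam lam C t₀ := by
  unfold gam; positivity

lemma two_mul_gam_le (hlam : 0 < lam) (ht₀ : 0 < t₀) :
    2 * gam lam C t₀ ≤ tailRate lam C t₀ := by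
  have hx : 0 < lam * t₀ := by positivity
  have h1 : 8 * lam * t₀ + 1 ≤ (8 * lam * t₀ + 1) ^ 3 :=
    le_self_pow₀ (by linarith) (by norm_num)
  have h2 : 1 ≤ Real.exp (800 * lam * t₀) := Real.one_le_exp (by positivity)
  have h3 : 2 * (1 + 16 * t₀ * (2 * lam + C)) ≤
      2 ^ 25 * (1 + C / lam) * (8 * lam * t₀ + 1) ^ 3 * Real.exp (800 * lam * t₀) := by
    calc 2 * (1 + 16 * t₀ * (2 * lam + C)) ≤ 2 ^ 25 * (1 + C / lam) * (8 * lam * t₀ + 1) := by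
          have e : 2 ^ 25 * (1 + C / lam) * (8 * lam * t₀ + 1) =
              2 ^ 25 * (8 * lam * t₀ + 1 + 8 * C * t₀ + C / lam) := by
            field_simp; ring
          rw [e]
          have : 0 ≤ (C : ℝ) * t₀ := by positivity
          have : 0 ≤ (C : ℝ) / lam := by positivity
          linarith
      _ ≤ 2 ^ 25 * (1 + C / lam) * (8 * lam * t₀ + 1) ^ 3 := by gcongr
      _ ≤ _ := le_mul_of_one_le_right (by positivity) h2
  unfold gam tailRate
  rw [mul_one_div, div_le_div_iff₀ (by positivity) (by positivity), one_mul]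
  exact h3

/-- With `q` the fourth root of `x`, `log x = 4 log q ≤ 4 (q - 1)`, and this is below `q ^ 2 / 4`
because `q ≥ 64`. -/
lemma log_le_sqrt_div_four {x : ℝ} (hx : 2 ^ 24 ≤ x) : Real.log x ≤ √x / 4 := by
  have hx0 : 0 < x := by linarith [show (0 : ℝ) < 2 ^ 24 by norm_num]
  set q := √√x with hq
  have h1 : q ^ 2 = √x := Real.sq_sqrt (Real.sqrt_nonneg _)
  have h2 : √x ^ 2 = x := Real.sq_sqrt hx0.le
  have hqpos : 0 < q := Real.sqrt_pos.2 (Real.sqrt_pos.2 hx0)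
  have h3 : (2 : ℝ) ^ 6 ≤ q := by
    refine le_of_pow_le_pow_left₀ (n := 4) (by norm_num) hqpos.le ?_
    calc ((2 : ℝ) ^ 6) ^ 4 = 2 ^ 24 := by norm_num
      _ ≤ x := hx
      _ = q ^ 4 := by rw [← h2, ← h1]; ring
  have h4 : Real.log x = 4 * Real.log q := by
    rw [show x = q ^ 4 by rw [← h2, ← h1]; ring, Real.log_pow]; norm_num
  have h5 := Real.log_le_sub_one_of_pos hqpos
  rw [h4, ← h1]
  nlinarith

/-- Write `β` for `tailRate`, `γ` for `gam` and `ℓ` for `log n`. The linear term of the exponent is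
`-β ℓ²`, and `β` is chosen so small that the quadratic term takes back at most half of it. The
prefactor and the extra `exp 1` are at most `n³ = exp(3ℓ)`, which is absorbed because `β ≥ 2γ` and
`γ ℓ ≥ 8`. -/
lemma prob_bound (hlam : 0 < lam) (ht₀ : 0 < t₀)
    (hn1 : 2 ^ 18 * (lam + 1 / lam) ^ 4 * ((C : ℝ) + 1) ^ 6 * (t₀ + 1 / t₀) ^ 2 ≤ (n : ℝ))
    (hn2 : Real.exp (8 / gam lam C t₀) ≤ (n : ℝ)) {θ : ℝ}
    (hθ : θ = tailRate lam C t₀ * Real.log n / √n) :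
    6 * (n : ℝ) ^ 2 * ((C : ℝ) + 1) ^ 2 *
      Real.exp (-(θ * (√n * Real.log n)) + t₀ * (θ ^ 2 * (8 * n * (2 * lam + C)) + 1 / t₀)) ≤
      Real.exp (-(1 / 2) * gam lam C t₀ * Real.log n ^ 2) := by
  have hC := two_pow_mul_le hlam ht₀ hn1
  have hC1 : 1 ≤ ((C : ℝ) + 1) ^ 2 := one_le_pow₀ (by linarith [Nat.cast_nonneg (α := ℝ) C])
  have hn0 : (0 : ℝ) < n := by linarith
  have hγ := gam_pos (C := C) hlam ht₀
  have hβ := tailRate_pos (C := C) hlam ht₀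
  have hβγ := two_mul_gam_le (C := C) hlam ht₀
  have hlog : 8 / gam lam C t₀ ≤ Real.log n := (Real.le_log_iff_exp_le hn0).2 hn2
  have hlog0 : 0 < Real.log n := lt_of_lt_of_le (by positivity) hlog
  set β := tailRate lam C t₀ with hβdef
  set ℓ := Real.log n with hℓ
  have hsq : √(n : ℝ) ^ 2 = n := Real.sq_sqrt hn0.le
  have hs0 : 0 < √(n : ℝ) := Real.sqrt_pos.2 hn0
  have e1 : θ * (√n * ℓ) = β * ℓ ^ 2 := by
    rw [hθ]; field_simp
  have e2 : t₀ * (θ ^ 2 * (8 * n * (2 * lam + C)) + 1 / t₀) =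
      β ^ 2 * ℓ ^ 2 * (8 * t₀ * (2 * lam + C)) + 1 := by
    have : θ ^ 2 * n = β ^ 2 * ℓ ^ 2 := by
      rw [hθ, div_pow, hsq]; field_simp
    calc _ = (θ ^ 2 * n) * (8 * t₀ * (2 * lam + C)) + t₀ * (1 / t₀) := by ring
      _ = _ := by rw [this, mul_one_div_cancel ht₀.ne']
  have e3 : β * (16 * t₀ * (2 * lam + C)) ≤ 1 := by
    rw [hβdef, tailRate, one_div, inv_mul_le_iff₀ (by positivity)]
    linarith
  have e4 : β ^ 2 * ℓ ^ 2 * (8 * t₀ * (2 * lam + C)) ≤ β / 2 * ℓ ^ 2 := by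
    calc β ^ 2 * ℓ ^ 2 * (8 * t₀ * (2 * lam + C))
        = β / 2 * ℓ ^ 2 * (β * (16 * t₀ * (2 * lam + C))) := by ring
      _ ≤ β / 2 * ℓ ^ 2 * 1 := mul_le_mul_of_nonneg_left e3 (by positivity)
      _ = _ := mul_one _
  have e5 : 6 * (n : ℝ) ^ 2 * ((C : ℝ) + 1) ^ 2 * Real.exp 1 ≤ Real.exp (3 * ℓ) := by
    have : Real.exp (3 * ℓ) = (n : ℝ) ^ 3 := by
      rw [show 3 * ℓ = ((3 : ℕ) : ℝ) * ℓ by norm_num, Real.exp_nat_mul, hℓ, Real.exp_log hn0]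
    rw [this]
    have h3 : Real.exp 1 ≤ 3 := Real.exp_one_lt_three.le
    calc 6 * (n : ℝ) ^ 2 * ((C : ℝ) + 1) ^ 2 * Real.exp 1
        ≤ 6 * (n : ℝ) ^ 2 * ((C : ℝ) + 1) ^ 2 * 3 := by gcongr
      _ = (n : ℝ) ^ 2 * (18 * ((C : ℝ) + 1) ^ 2) := by ring
      _ ≤ (n : ℝ) ^ 2 * n := by gcongr; linarith
      _ = _ := by ring
  have e6 : 3 * ℓ ≤ (β - gam lam C t₀) / 2 * ℓ ^ 2 := by
    rw [div_le_iff₀ hγ] at hlog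
    have h1 := mul_le_mul_of_nonneg_right hlog hlog0.le
    have h2 : gam lam C t₀ / 2 * ℓ ^ 2 ≤ (β - gam lam C t₀) / 2 * ℓ ^ 2 :=
      mul_le_mul_of_nonneg_right (by linarith) (sq_nonneg _)
    linarith
  calc _ ≤ 6 * (n : ℝ) ^ 2 * ((C : ℝ) + 1) ^ 2 * Real.exp (1 + -(β / 2 * ℓ ^ 2)) := by
        refine mul_le_mul_of_nonneg_left (Real.exp_le_exp.2 ?_) (by positivity)
        rw [e1, e2]
        linarith
    _ = 6 * (n : ℝ) ^ 2 * ((C : ℝ) + 1) ^ 2 * Real.exp 1 * Real.exp (-(β / 2 * ℓ ^ 2)) := by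
        rw [Real.exp_add]; ring
    _ ≤ Real.exp (3 * ℓ) * Real.exp (-(β / 2 * ℓ ^ 2)) := by gcongr
    _ = Real.exp (3 * ℓ + -(β / 2 * ℓ ^ 2)) := (Real.exp_add _ _).symm
    _ ≤ _ := Real.exp_le_exp.2 (by linarith)

/-- Since `√n log n ≥ 1`, the constants 2 and `4 * lam * t₀` are absorbed by multiples of `√n log
n`; the exponential rate `growth` is below the stated one. -/
lemma deviation_le_errorBound (hlam : 0 < lam) (ht₀ : 0 < t₀) (hn : 2 ^ 24 ≤ (n : ℝ))
    (ξ₀ : Fin (C + 1) → ℝ) (x : Route n → ℕ) :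
    (√n * Real.log n + 2 +
        (⨆ p : Fin n × Fin (C + 1), |(numLinks x p.1 p.2 : ℝ) - ((n : ℝ) - 1) * ξ₀ p.2|) +
        n * phi C x + 4 * lam * t₀) * Real.exp (growth lam C * t₀) ≤
      errorBound lam C t₀ ξ₀ x := by
  have hn2 : 2 < n := by
    have : (2 : ℝ) < n := by linarith [show (2 : ℝ) < 2 ^ 24 by norm_num]
    exact_mod_cast this
  have hφ : 0 ≤ n * phi C x := mul_nonneg (Nat.cast_nonneg _) (phi_nonneg hn2 _)
  have hA : 0 ≤ ⨆ p : Fin n × Fin (C + 1), |(numLinks x p.1 p.2 : ℝ) - ((n : ℝ) - 1) * ξ₀ p.2| :=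
    Real.iSup_nonneg fun _ => abs_nonneg _
  have hs : 1 ≤ √(n : ℝ) := Real.one_le_sqrt.2 (by linarith [show (1 : ℝ) ≤ 2 ^ 24 by norm_num])
  have hl : 1 ≤ Real.log n := by
    rw [Real.le_log_iff_exp_le (by linarith [show (0 : ℝ) < 2 ^ 24 by norm_num])]
    linarith [Real.exp_one_lt_three, show (3 : ℝ) ≤ 2 ^ 24 by norm_num]
  have hsl : 1 ≤ √(n : ℝ) * Real.log n := one_le_mul_of_one_le_of_one_le hs hl
  have hC0 : (0 : ℝ) ≤ C := Nat.cast_nonneg C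
  have hC3 : (1 : ℝ) ≤ ((C : ℝ) + 1) ^ 3 := one_le_pow₀ (by linarith)
  have hlt : 0 < lam * t₀ := by positivity
  have hZ : 64 * (1 + lam * t₀) ≤ 64 * (lam + 1) * (t₀ + 1) * ((C : ℝ) + 1) ^ 3 := by
    calc 64 * (1 + lam * t₀) ≤ 64 * (lam + 1) * (t₀ + 1) := by nlinarith
      _ ≤ _ := le_mul_of_one_le_right (by positivity) hC3
  unfold errorBound
  rw [mul_assoc 3, ← Real.sqrt_eq_rpow]
  set W := √(n : ℝ) * Real.log n
  set A := ⨆ p : Fin n × Fin (C + 1), |(numLinks x p.1 p.2 : ℝ) - ((n : ℝ) - 1) * ξ₀ p.2|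
  set Φ := n * phi C x
  have hmain : W + 2 + A + Φ + 4 * lam * t₀ ≤
      A + 64 * (lam + 1) * (t₀ + 1) * ((C : ℝ) + 1) ^ 3 * (Φ + 3 * W) := by
    have h1 : 64 * (1 + lam * t₀) * (Φ + 3 * W) ≤
        64 * (lam + 1) * (t₀ + 1) * ((C : ℝ) + 1) ^ 3 * (Φ + 3 * W) :=
      mul_le_mul_of_nonneg_right hZ (by linarith)
    have h2 : lam * t₀ ≤ lam * t₀ * W := le_mul_of_one_le_right hlt.le hsl
    have h3 : 0 ≤ lam * t₀ * Φ := by positivity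
    linarith
  have hexp : Real.exp (growth lam C * t₀) ≤ Real.exp (216 * (lam + 1) * ((C : ℝ) + 1) * t₀) := by
    refine Real.exp_le_exp.2 (mul_le_mul_of_nonneg_right ?_ ht₀.le)
    unfold growth
    nlinarith [mul_nonneg hlam.le hC0]
  exact mul_le_mul hmain hexp (Real.exp_nonneg _) (by positivity)

end Numerics

/-! ### From grid times to all times -/

section GridApproximation

variable {t₀ : ℝ}

/-- Every time is approximated from the right by grid times. -/
lemma exists_tendsto_gridTime (ht₀ : 0 < t₀) {t : ℝ≥0} (ht : (t : ℝ) ≤ t₀) :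
    ∃ i : ℕ → ℕ, (∀ m, i m ≤ 2 ^ m) ∧
      Tendsto (fun m => gridTime t₀ m (i m)) atTop (𝓝[≥] t) := by
  have hmul : ∀ m : ℕ, (t : ℝ) * 2 ^ m / t₀ * (t₀ / 2 ^ m) = t := fun m => by field_simp
  have hmesh : ∀ m : ℕ, 0 < t₀ / 2 ^ m := fun m => by positivity
  have hlb : ∀ m : ℕ, (t : ℝ) ≤ ⌈(t : ℝ) * 2 ^ m / t₀⌉₊ * (t₀ / 2 ^ m) := fun m => by
    conv_lhs => rw [← hmul m]
    exact mul_le_mul_of_nonneg_right (Nat.le_ceil _) (hmesh m).le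
  have hub : ∀ m : ℕ, ⌈(t : ℝ) * 2 ^ m / t₀⌉₊ * (t₀ / 2 ^ m) ≤ t + t₀ / 2 ^ m := fun m => by
    have h := mul_le_mul_of_nonneg_right
      (Nat.ceil_lt_add_one (show 0 ≤ (t : ℝ) * 2 ^ m / t₀ by positivity)).le (hmesh m).le
    rwa [add_mul, hmul, one_mul] at h
  -- Rounding up gives grid times at or after `t`, the side on which the paths are continuous; `t ≤
  -- t₀` keeps the index at most `2 ^ m`.
  refine ⟨fun m => ⌈(t : ℝ) * 2 ^ m / t₀⌉₊, fun m => ?_, ?_⟩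
  · refine Nat.ceil_le.2 ?_
    rw [div_le_iff₀ ht₀, mul_comm]
    push_cast
    exact mul_le_mul_of_nonneg_left ht (by positivity)
  · refine tendsto_nhdsWithin_iff.2 ⟨?_, Eventually.of_forall fun m => ?_⟩
    · rw [← NNReal.tendsto_coe]
      simp only [coe_gridTime ht₀.le]
      refine tendsto_of_tendsto_of_tendsto_of_le_of_le tendsto_const_nhds ?_ hlb hub
      simpa using (tendsto_mesh t₀).const_add (t : ℝ)
    · show t ≤ _
      rw [← NNReal.coe_le_coe, coe_gridTime ht₀.le]
      exact hlb m

/-- Almost surely `D` lies in the increasing union of the tail intersections of the `B m`.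
Continuity from below for such unions needs no measurability, which matters since `D` is a condition
at uncountably many times. -/
lemma measure_le_of_ae_eventually {Ω : Type*} [MeasurableSpace Ω] {P : Measure Ω}
    {D : Set Ω} {B : ℕ → Set Ω} {b : ℝ≥0∞} (hB : ∀ᶠ m in atTop, P (B m) ≤ b)
    (hD : ∀ᵐ ω ∂P, ω ∈ D → ∀ᶠ m in atTop, ω ∈ B m) : P D ≤ b := by
  obtain ⟨M₀, hM₀⟩ := eventually_atTop.1 hB
  have hmono : Monotone fun M => ⋂ m ≥ M, B m := fun M M' hMM' =>
    biInter_subset_biInter_left fun m (hm : M' ≤ m) => hMM'.trans hm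
  calc P D ≤ P (⋃ M, ⋂ m ≥ M, B m) := by
        refine measure_mono_ae ?_
        filter_upwards [hD] with ω hω hωD
        obtain ⟨M, hM⟩ := eventually_atTop.1 (hω hωD)
        exact mem_iUnion.2 ⟨M, mem_iInter₂.2 hM⟩
    _ = ⨆ M, P (⋂ m ≥ M, B m) := hmono.measure_iUnion
    _ ≤ b := iSup_le fun M => (measure_mono (biInter_subset_of_mem (le_max_left M M₀))).trans
        (hM₀ _ (le_max_right M M₀))

end GridApproximation

end Routing

/-! ### The deviation bound -/

theorem theorem1p2 {Ω : Type*} [MeasurableSpace Ω] (P : Measure Ω) [IsProbabilityMeasure P]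
    (lam t₀ : ℝ) (hlam : 0 < lam) (ht₀ : 0 < t₀) (C : ℕ) (hC : 1 ≤ C) (n : ℕ)
    (hn : max (2 ^ 18 * (lam + 1 / lam) ^ 4 * ((C : ℝ) + 1) ^ 6 * (t₀ + 1 / t₀) ^ 2)
      (Real.exp (8 / Routing.gam lam C t₀)) ≤ (n : ℝ))
    (ξ₀ : Fin (C + 1) → ℝ) (hξ₀ : ξ₀ ∈ stdSimplex ℝ (Fin (C + 1)))
    (X : ℝ≥0 → Ω → Routing.State n C) (hX : Routing.IsRoutingProcess P n C lam X)
    (hX₀ : ∀ᵐ ω ∂P, ((∑ r, (X 0 ω).1 r : ℕ) : ℝ) ≤ 2 * lam * (n.choose 2 : ℝ)) :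
    ∃ ξ : ℝ → Fin (C + 1) → ℝ,
      Routing.IsSolution C lam t₀ ξ₀ ξ ∧
      (∀ η : ℝ → Fin (C + 1) → ℝ, Routing.IsSolution C lam t₀ ξ₀ η → EqOn η ξ (Icc 0 t₀)) ∧
      P {ω | ¬ ∀ (v : Fin n) (k : Fin (C + 1)) (t : ℝ≥0), (t : ℝ) ≤ t₀ →
          |(Routing.numLinks (X t ω).1 v k : ℝ) - ((n : ℝ) - 1) * ξ t k| ≤
            Routing.errorBound lam C t₀ ξ₀ (X 0 ω).1} ≤
        ENNReal.ofReal (Real.exp (-(1 / 2) * Routing.gam lam C t₀ * Real.log n ^ 2)) := by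
  open Routing in
  obtain ⟨ξ, hξ, hs⟩ := exists_isSolution hlam.le ht₀.le hξ₀
  refine ⟨ξ, hξ, fun η hη => hη.eqOn hξ, ?_⟩
  have hn1 := (le_max_left _ _).trans hn
  have hn2 := (le_max_right _ _).trans hn
  have hnC := two_pow_mul_le hlam ht₀ hn1
  have hn24 : (2 : ℝ) ^ 24 ≤ n := by
    have : 1 ≤ ((C : ℝ) + 1) ^ 2 := one_le_pow₀ (by linarith [Nat.cast_nonneg (α := ℝ) C])
    linarith
  have hn3 : 2 < n := by
    have : (2 : ℝ) < n := by linarith [show (2 : ℝ) < 2 ^ 24 by norm_num]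
    exact_mod_cast this
  have hlog : 0 < Real.log n := Real.log_pos (by linarith [show (1 : ℝ) < 2 ^ 24 by norm_num])
  have hsqrt : 0 < √(n : ℝ) := Real.sqrt_pos.2 (by linarith [show (0 : ℝ) < 2 ^ 24 by norm_num])
  -- With threshold `√n log n`, this exponent makes both the linear term and the variance term of
  -- the tail bound multiples of `log² n`.
  obtain ⟨θ, hθ⟩ : ∃ θ, θ = tailRate lam C t₀ * Real.log n / √n := ⟨_, rfl⟩
  have hβ := tailRate_pos (C := C) hlam ht₀
  have hθ0 : 0 < θ := by rw [hθ]; positivity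
  have hθ4 : 4 * θ ≤ 1 := by
    rw [hθ, mul_div_assoc', div_le_one hsqrt]
    have h1 := log_le_sqrt_div_four hn24
    have h2 : tailRate lam C t₀ * Real.log n ≤ Real.log n :=
      mul_le_of_le_one_left hlog.le (tailRate_le_one hlam ht₀)
    linarith
  have ha : 0 ≤ √(n : ℝ) * Real.log n := by positivity
  refine measure_le_of_ae_eventually (B := fun m => {ω | ∃ o : ObsIndex n C,
      Exceeds (fun s : State n C => θ * obs o s.1)
        (fun s => t₀ / 2 ^ m * ∑ z, generator n C lam s z * (θ * obs o z.1 - θ * obs o s.1))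
        (θ * (√(n : ℝ) * Real.log n)) (fun i : Fin (2 ^ m + 1) => X (gridTime t₀ m i) ω)}) ?_ ?_
  -- The slack `ε = 1 / t₀` costs a factor `exp 1` in the probability.
  · filter_upwards [eventually_measureReal_exceeds_le (a := √(n : ℝ) * Real.log n) hlam.le hn3 hX
      ht₀ hθ0.le hθ4 (one_div_pos.2 ht₀)] with m hm
    rw [← ofReal_measureReal (measure_ne_top _ _)]
    refine ENNReal.ofReal_le_ofReal (hm.trans ?_)
    exact (mul_le_mul_of_nonneg_right (card_obsIndex_le n C (by omega)) (Real.exp_nonneg _)).trans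
      (prob_bound hlam ht₀ hn1 hn2 hθ)
  · filter_upwards [hX.right_continuous] with ω hω hbad
    simp only [not_forall, not_le] at hbad
    obtain ⟨v, k, t, ht, hbad⟩ := hbad
    obtain ⟨i, hi, hlim⟩ := exists_tendsto_gridTime ht₀ ht
    -- At grid times approaching `t` from the right, the state is eventually exactly `X t ω` and the
    -- solution tends to `ξ t`, so the strict violation of the bound persists there.
    have hXlim := hlim.eventually (hω t)
    have hξlim : Tendsto (fun m => ξ (gridTime t₀ m (i m)) k) atTop (𝓝 (ξ t k)) := by
      have h1 : ContinuousWithinAt (fun s => ξ s k) (Icc 0 t₀) t :=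
        ((continuous_apply k).comp_continuousOn hξ.continuousOn) t ⟨t.2, ht⟩
      refine h1.tendsto.comp (tendsto_nhdsWithin_iff.2 ⟨?_, Eventually.of_forall fun m => ?_⟩)
      · exact (NNReal.tendsto_coe.2 (tendsto_nhdsWithin_iff.1 hlim).1)
      · refine ⟨NNReal.coe_nonneg _, ?_⟩
        rw [coe_gridTime ht₀.le]
        exact natCast_mul_mesh_le ht₀.le (hi m)
    have hdev := ((tendsto_const_nhds.sub (hξlim.const_mul ((n : ℝ) - 1))).abs).eventually
      (lt_mem_nhds hbad)
    filter_upwards [hXlim, hdev, hξ.eventually_closeTo hlam.le hn3 ht₀ hs hθ0 ha] with m h1 h2 h3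
    -- If no observable had a large martingale part on this grid, the path would satisfy the
    -- deviation bound at the grid time near `t`.
    by_contra hne
    have h4 := h3 (fun i => X (gridTime t₀ m i) ω) hne
      (⨆ p : Fin n × Fin (C + 1),
        |(numLinks (X 0 ω).1 p.1 p.2 : ℝ) - ((n : ℝ) - 1) * ξ₀ p.2|) ?_ (i m) (hi m)
    · have h5 := h4.star v k (Nat.le_of_lt_succ k.2)
      rw [starCount_eq_numLinks, profile_coe, ← coe_gridTime ht₀.le, h1, gridTime_zero] at h5
      exact absurd (h5.trans (deviation_le_errorBound hlam ht₀ hn24 ξ₀ _)) (not_le.2 h2)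
    · intro v k hk
      rw [starCount_eq_numLinks, gridTime_zero]
      have hk' := profile_coe ξ₀ ⟨k, Nat.lt_succ_of_le hk⟩
      simp only at hk'
      rw [hk']
      exact le_ciSup (Set.finite_range (fun p : Fin n × Fin (C + 1) =>
        |(numLinks (X 0 ω).1 p.1 p.2 : ℝ) - ((n : ℝ) - 1) * ξ₀ p.2|)).bddAbove
        (v, ⟨k, Nat.lt_succ_of_le hk⟩)
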